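/- Let $\alpha,\beta>-1$ be real with $\alpha+\beta\neq-1$, and let $n,N$ be integers with $1\le n\le N-1$. Let \[ \omega(x)=\frac{\Gamma(N+\alpha-x)\,\Gamma(\beta+x+1)}{(N-x-1)!\,x!},\qquad x=0,1,\dots,N-1, \] and let $h_n^{\alpha,\beta}(x,N)$ be the monic Hahn polynomial of degree $n$, i.e. the $n$-th monic orthogonal polynomial with respect to the weight $\omega$ on $\{0,\dots,N-1\}$. Its relative Fisher information is \[ I_\omega[h_n^{\alpha,\beta}(N)]=\frac1{d_n^2}\sum_{x=0}^{N-1}\omega(x)\bigl[h_n^{\alpha,\beta}(x+1,N)-h_n^{\alpha,\beta}(x,N)\bigr]^2,\qquad d_n^2=\sum_{x=0}^{N-1}\omega(x)\,h_n^{\alpha,\beta}(x,N)^2 . \] Write $(a)_k=a(a+1)\cdots(a+k-1)$, and let ${}_pF_q(a_1,\dots,a_p;b_1,\dots,b_q\,|\,z)$ be the generalized hypergeometric function, that is, the holomorphic continuation to $\mathbb C\setminus[1,\infty)$ of the sum of the series $\sum_k \frac{(a_1)_k\cdots(a_p)_k}{(b_1)_k\cdots(b_q)_k}\frac{z^k}{k!}$,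 $|z|<1$ (a series with an upper parameter $1-n$ terminates at $k=n-1$). Then the continuation of the ${}_3F_2$ in $C_3$ below exists, and \[ I_\omega[h_n^{\alpha,\beta}(N)]=A_1A_2\,(B_1B_2B_3+C_1C_2C_3+D_1D_2D_3), \] where \[ A_1=\frac{n^2(\alpha+\beta+2n+1)(N-n-1)!\,\Gamma(\alpha+\beta+n+1)}{n!\,\Gamma(\alpha+n+1)\Gamma(\beta+n+1)\Gamma(\alpha+\beta+N+n+1)}, \] \[ A_2=\frac{((\alpha+\beta+n+1)_n)^2\,\Gamma(\alpha+1)\Gamma(\beta+1)\Gamma(\alpha+\beta+N+1)}{(\alpha+\beta+1)(N-1)!\,\Gamma(\alpha+\beta+1)}, \] \[ B_1=\left(\frac{(n-1)!(\beta+1)(\alpha+\beta+N+1)(-\alpha-\beta-n-N)_{n-1}(\beta+2)_{n-1}}{(\alpha+\beta+n+2)_{n-1}(-\alpha-\beta-n-1)_{n-1}(\alpha+\beta+2)(N+\beta)}\right)^2, \] \[ B_2=\frac{(-1)^{n-1}(\alpha+1)_{n-1}\left(\frac{\alpha+\beta+3}{2}\right)_{n-1}(\alpha+\beta+1)_{n-1}(1-N)_{n-1}}{(n-1)!\left(\frac{\alpha+\beta+1}{2}\right)_{n-1}(\beta+1)_{n-1}(\alpha+\beta+N+1)_{n-1}},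 \] \[ B_3={}_5F_4\left(\left.\begin{array}{c}1-n,\,1,\,1-n-\beta,\,1-n-\alpha-\beta-N,\,2-n-\frac{\alpha+\beta+1}{2}\\ 1-n-\alpha,\,2-n-\frac{\alpha+\beta+3}{2},\,1-n-\alpha-\beta,\,1-n+N\end{array}\right|-1\right), \] \[ C_1=\frac{2(-1)^n((n-1)!)^2(\beta+1)(\alpha+\beta+N+1)(-\alpha-\beta-n-N)_{n-1}}{(\alpha+\beta+n+2)_{n-1}^2\,(-\alpha-\beta-n-1)_{n-1}^2\,(\alpha+\beta+2)^2}, \] \[ C_2=\frac{(\beta+2)_{n-1}(1-N)(\alpha+1)(-\alpha-n)_{n-1}(2-N)_{n-1}(\alpha+\beta+2n+1)}{n!\,(-N-\beta)^2\,\Gamma(\alpha+\beta+2)}, \] \[ C_3=\Gamma(\alpha+\beta+n+1)\;{}_3F_2\left(\left.\begin{array}{c}1,\,\frac{\alpha+\beta+3}{2}+n,\,\alpha+\beta+n+1\\ n+1,\,\frac{\alpha+\beta+1}{2}+n\end{array}\right|-1\right), \] \[ D_1=\left(\frac{(n-1)!(N-1)(\alpha+1)(-\alpha-n)_{n-1}(-N+2)_{n-1}}{(\alpha+\beta+n+2)_{n-1}(-\alpha-\beta-n-1)_{n-1}(\alpha+\beta+2)(N+\beta)}\right)^2,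 \] \[ D_2=\frac{(-1)^{n-1}\left(\frac{\alpha+\beta+3}{2}\right)_{n-1}(\beta+1)_{n-1}(\alpha+\beta+N+1)_{n-1}(\alpha+\beta+1)_{n-1}}{(n-1)!\,(1-N)_{n-1}(\alpha+1)_{n-1}\left(\frac{\alpha+\beta+1}{2}\right)_{n-1}}, \] \[ D_3={}_5F_4\left(\left.\begin{array}{c}1-n,\,1,\,1-n+N,\,1-n-\alpha,\,2-n-\frac{\alpha+\beta+1}{2}\\ 2-n-\frac{\alpha+\beta+3}{2},\,1-n-\beta,\,1-n-\alpha-\beta-N,\,1-n-\alpha-\beta\end{array}\right|-1\right). \] -/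

import Mathlib

open Polynomial

/-! ### Monic orthogonal polynomials of a discrete variable and their relative Fisher information -/

/-- The bilinear form `∑_{x=0}^{N-1} ω(x) p(x) q(x)`. -/
noncomputable def discreteForm (ω : ℕ → ℝ) (N : ℕ) (p q : ℝ[X]) : ℝ :=
  ∑ x ∈ Finset.range N, ω x * p.eval (x : ℝ) * q.eval (x : ℝ)

/-- The monic orthogonal polynomials of the weight `ω` on `{0, …, N-1}`, by Gram-Schmidt
orthogonalization of `1, X, X², …` (without normalization). Only the degrees `n ≤ N - 1` are
meaningful. -/
noncomputable def monicOrthogonal (ω : ℕ → ℝ) (N : ℕ) (n : ℕ) : ℝ[X] :=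
  X ^ n - ∑ k : Fin n,
    C (discreteForm ω N (X ^ n) (monicOrthogonal ω N k) /
        discreteForm ω N (monicOrthogonal ω N k) (monicOrthogonal ω N k)) *
      monicOrthogonal ω N k
termination_by n
decreasing_by all_goals exact k.2

/-- The relative Fisher information `d⁻² ∑_{x=0}^{N-1} ω(x) [Δp(x)]²`, where
`d² = ∑_{x=0}^{N-1} ω(x) p(x)²` and `Δp(x) = p(x+1) - p(x)`. -/
noncomputable def relativeFisherInformation (ω : ℕ → ℝ) (N : ℕ) (p : ℝ[X]) : ℝ :=
  1 / discreteForm ω N p p *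
    ∑ x ∈ Finset.range N, ω x * (p.eval ((x : ℝ) + 1) - p.eval (x : ℝ)) ^ 2

/-- The Hahn weight `Γ(N+α-x) Γ(β+x+1) / ((N-x-1)! x!)` at `x ∈ {0, …, N-1}`. -/
noncomputable def hahnWeight (N : ℕ) (α β : ℝ) (x : ℕ) : ℝ :=
  Real.Gamma (N + α - x) * Real.Gamma (β + x + 1) /
    (((N - x - 1).factorial : ℝ) * (x.factorial : ℝ))

/-- The monic Hahn polynomial `h_n^{α,β}(x,N)`. -/
noncomputable def hahnPolynomial (N : ℕ) (α β : ℝ) (n : ℕ) : ℝ[X] :=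
  monicOrthogonal (hahnWeight N α β) N n

theorem hahnWeight_pos {N : ℕ} {α β : ℝ} (hα : -1 < α) (hβ : -1 < β) {x : ℕ} (hx : x < N) :
    0 < hahnWeight N α β x := by
  have h : (x : ℝ) + 1 ≤ N := by exact_mod_cast hx
  have hx0 : (0 : ℝ) ≤ x := Nat.cast_nonneg x
  unfold hahnWeight
  have h1 := Real.Gamma_pos_of_pos (show 0 < (N : ℝ) + α - x by linarith)
  have h2 := Real.Gamma_pos_of_pos (show 0 < β + (x : ℝ) + 1 by linarith)
  positivity

theorem monicOrthogonal_monic_degree (ω : ℕ → ℝ) (N n : ℕ) :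
    (monicOrthogonal ω N n).Monic ∧ (monicOrthogonal ω N n).degree = n := by
  induction n using Nat.strong_induction_on with
  | _ n ih =>
    have hlt : (∑ k : Fin n,
        C (discreteForm ω N (X ^ n) (monicOrthogonal ω N k) /
            discreteForm ω N (monicOrthogonal ω N k) (monicOrthogonal ω N k)) *
          monicOrthogonal ω N k).degree < (n : WithBot ℕ) := by
      refine (Polynomial.degree_sum_le _ _).trans_lt ?_
      refine (Finset.sup_lt_iff (WithBot.bot_lt_coe n)).2 ?_
      intro k _
      refine (Polynomial.degree_mul_le _ _).trans_lt ?_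
      refine (add_le_add_left Polynomial.degree_C_le _).trans_lt ?_
      rw [zero_add, (ih k k.2).2]
      exact WithBot.coe_lt_coe.2 k.2
    rw [monicOrthogonal]
    refine ⟨Polynomial.monic_X_pow_sub hlt, ?_⟩
    rw [Polynomial.degree_sub_eq_left_of_degree_lt] <;> simp only [Polynomial.degree_X_pow]
    exact hlt

theorem discreteForm_self_pos {ω : ℕ → ℝ} {N : ℕ} (hω : ∀ x < N, 0 < ω x) {p : ℝ[X]}
    (hp : p ≠ 0) (hN : p.natDegree < N) : 0 < discreteForm ω N p p := by
  have h0 : ∀ x ∈ Finset.range N, 0 ≤ ω x * p.eval (x : ℝ) * p.eval (x : ℝ) := by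
    intro x hx
    rw [mul_assoc]
    exact mul_nonneg (hω x (Finset.mem_range.1 hx)).le (mul_self_nonneg _)
  refine lt_of_le_of_ne (Finset.sum_nonneg h0) fun h => hp ?_
  refine Polynomial.eq_zero_of_natDegree_lt_card_of_eval_eq_zero p
    (f := fun x : Fin N => ((x : ℕ) : ℝ)) (fun a b hab => Fin.ext (Nat.cast_injective hab)) ?_
    (by simpa using hN)
  intro x
  have := (Finset.sum_eq_zero_iff_of_nonneg h0).1 h.symm x (Finset.mem_range.2 x.2)
  rw [mul_assoc] at this
  exact mul_self_eq_zero.1 ((mul_eq_zero.1 this).resolve_left (hω x x.2).ne')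

/-- The polynomials constructed above satisfy the orthogonality relation in the degrees
`0, …, N-1`. -/
theorem monicOrthogonal_orthogonal {ω : ℕ → ℝ} {N : ℕ} (hω : ∀ x < N, 0 < ω x) (n : ℕ) :
    n < N → ∀ m < n,
      discreteForm ω N (monicOrthogonal ω N n) (monicOrthogonal ω N m) = 0 := by
  induction n using Nat.strong_induction_on with
  | _ n ih =>
    intro hn m hm
    have hsymm : ∀ p q, discreteForm ω N p q = discreteForm ω N q p := fun p q =>
      Finset.sum_congr rfl fun x _ => by ring
    have hlin : ∀ (c : Fin n → ℝ) (p q : ℝ[X]) (r : Fin n → ℝ[X]),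
        discreteForm ω N (p - ∑ k, C (c k) * r k) q =
          discreteForm ω N p q - ∑ k, c k * discreteForm ω N (r k) q := by
      intro c p q r
      simp only [discreteForm, Polynomial.eval_sub, Polynomial.eval_finsetSum,
        Polynomial.eval_mul, Polynomial.eval_C, Finset.mul_sum]
      rw [Finset.sum_comm, ← Finset.sum_sub_distrib]
      refine Finset.sum_congr rfl fun x _ => ?_
      rw [mul_sub, sub_mul, Finset.mul_sum, Finset.sum_mul]
      congr 1
      exact Finset.sum_congr rfl fun k _ => by ring
    have hpos : 0 < discreteForm ω N (monicOrthogonal ω N m) (monicOrthogonal ω N m) := by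
      obtain ⟨h1, h2⟩ := monicOrthogonal_monic_degree ω N m
      refine discreteForm_self_pos hω h1.ne_zero ?_
      rw [Polynomial.natDegree_eq_of_degree_eq_some h2]
      omega
    rw [monicOrthogonal.eq_1 ω N n, hlin, Finset.sum_eq_single (⟨m, hm⟩ : Fin n)]
    · simp only
      rw [div_mul_cancel₀ _ hpos.ne', sub_self]
    · intro k _ hk
      have hkm : (k : ℕ) ≠ m := fun h => hk (Fin.ext h)
      rcases lt_or_gt_of_ne hkm with h | h
      · rw [hsymm (monicOrthogonal ω N k) (monicOrthogonal ω N m), ih m hm (by omega) k h, mul_zero]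
      · rw [ih k k.2 (by omega) m h, mul_zero]
    · simp

/-! ### Generalized hypergeometric functions -/

/-- The Pochhammer symbol `(a)_k = a (a+1) ⋯ (a+k-1)`. -/
noncomputable def poch (a : ℝ) (k : ℕ) : ℝ := (ascPochhammer ℝ k).eval a

/-- The coefficient `(a₁)_k ⋯ (a_p)_k / ((b₁)_k ⋯ (b_q)_k k!)` of the series `pFq`. -/
noncomputable def pFqCoeff (a b : List ℝ) (k : ℕ) : ℝ :=
  (a.map fun c => poch c k).prod / ((b.map fun c => poch c k).prod * (k.factorial : ℝ))

/-- The complex plane cut along `[1, ∞)`. -/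
def cutPlane : Set ℂ := {z | ¬ (1 ≤ z.re ∧ z.im = 0)}

/-- `F` is, on the plane cut along `[1, ∞)`, the holomorphic continuation of the hypergeometric
series with upper parameters `a` and lower parameters `b`, which converges to `F` on the open
unit disc. -/
def IsHypergeometricFunction (a b : List ℝ) (F : ℂ → ℂ) : Prop :=
  DifferentiableOn ℂ F cutPlane ∧
    ∀ z : ℂ, ‖z‖ < 1 → HasSum (fun k : ℕ => (pFqCoeff a b k : ℂ) * z ^ k) (F z)

open Classical in
/-- The generalized hypergeometric function `pFq(a; b | z)` on the plane cut along `[1, ∞)`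
(the default value `0` is taken if the continuation does not exist). -/
noncomputable def pFq (a b : List ℝ) (z : ℂ) : ℂ :=
  if h : ∃ F : ℂ → ℂ, IsHypergeometricFunction a b F then h.choose z else 0

/-- The value of `pFq` does not depend on the choice made in its definition. -/
theorem pFq_eq {a b : List ℝ} {F : ℂ → ℂ} (hF : IsHypergeometricFunction a b F) {z : ℂ}
    (hz : z ∈ cutPlane) : pFq a b z = F z := by
  have h : ∃ F : ℂ → ℂ, IsHypergeometricFunction a b F := ⟨F, hF⟩
  have hG := h.choose_spec
  rw [pFq, dif_pos h]
  have hopen : IsOpen cutPlane := by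
    have : IsClosed {z : ℂ | 1 ≤ z.re ∧ z.im = 0} :=
      (isClosed_le continuous_const Complex.continuous_re).inter
        (isClosed_eq Complex.continuous_im continuous_const)
    exact this.isOpen_compl
  have hmem : (0 : ℂ) ∈ cutPlane := by simp [cutPlane]
  have hstar : StarConvex ℝ (0 : ℂ) cutPlane := by
    rw [starConvex_zero_iff]
    rintro w hw t ht0 ht1 ⟨h1, h2⟩
    simp only [Complex.real_smul, Complex.re_ofReal_mul, Complex.im_ofReal_mul] at h1 h2
    rcases mul_eq_zero.1 h2 with h2 | h2
    · rw [h2] at h1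
      norm_num at h1
    · refine hw ⟨?_, h2⟩
      by_contra! h3
      rcases le_or_gt w.re 0 with h4 | h4
      · nlinarith [mul_nonneg ht0 (neg_nonneg.2 h4)]
      · nlinarith [mul_le_mul_of_nonneg_right ht1 h4.le]
  refine (hG.1.analyticOnNhd hopen).eqOn_of_preconnected_of_eventuallyEq
    (hF.1.analyticOnNhd hopen) (hstar.isPathConnected hmem).isConnected.isPreconnected
    hmem ?_ hz
  filter_upwards [Metric.ball_mem_nhds (0 : ℂ) one_pos] with w hw
  have hw' : ‖w‖ < 1 := by simpa using hw
  exact (hG.2 w hw').unique (hF.2 w hw')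

/-- A terminating series is a finite sum. -/
theorem pFq_terminating {a b : List ℝ} {m : ℕ} (ha : -(m : ℝ) ∈ a) {z : ℂ} (hz : z ∈ cutPlane) :
    pFq a b z = ∑ k ∈ Finset.range (m + 1), (pFqCoeff a b k : ℂ) * z ^ k := by
  refine pFq_eq (F := fun z => ∑ k ∈ Finset.range (m + 1), (pFqCoeff a b k : ℂ) * z ^ k)
    ⟨by fun_prop, fun w _ => hasSum_sum_of_ne_finset_zero fun k hk => ?_⟩ hz
  have hk' : m < k := by simpa using hk
  have h0 : poch (-(m : ℝ)) k = 0 := by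
    rw [poch, ascPochhammer_eval_neg_eq_descPochhammer]
    simp [descPochhammer_eval_eq_descFactorial, Nat.descFactorial_of_lt hk']
  have : (a.map fun c => poch c k).prod = 0 :=
    List.prod_eq_zero (List.mem_map.2 ⟨_, ha, h0⟩)
  simp [pFqCoeff, this]

/-! ### The factors of the closed formula -/

open Real in
noncomputable def hahnA1 (n N : ℕ) (α β : ℝ) : ℝ :=
  (n : ℝ) ^ 2 * (α + β + 2 * n + 1) * ((N - n - 1).factorial : ℝ) * Gamma (α + β + n + 1) /
    ((n.factorial : ℝ) * Gamma (α + n + 1) * Gamma (β + n + 1) * Gamma (α + β + N + n + 1))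

open Real in
noncomputable def hahnA2 (n N : ℕ) (α β : ℝ) : ℝ :=
  poch (α + β + n + 1) n ^ 2 * Gamma (α + 1) * Gamma (β + 1) * Gamma (α + β + N + 1) /
    ((α + β + 1) * ((N - 1).factorial : ℝ) * Gamma (α + β + 1))

noncomputable def hahnB1 (n N : ℕ) (α β : ℝ) : ℝ :=
  (((n - 1).factorial : ℝ) * (β + 1) * (α + β + N + 1) * poch (-α - β - n - N) (n - 1) *
      poch (β + 2) (n - 1) /
    (poch (α + β + n + 2) (n - 1) * poch (-α - β - n - 1) (n - 1) * (α + β + 2) * (N + β))) ^ 2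

noncomputable def hahnB2 (n N : ℕ) (α β : ℝ) : ℝ :=
  (-1) ^ (n - 1) * poch (α + 1) (n - 1) * poch ((α + β + 3) / 2) (n - 1) *
      poch (α + β + 1) (n - 1) * poch (1 - N) (n - 1) /
    (((n - 1).factorial : ℝ) * poch ((α + β + 1) / 2) (n - 1) * poch (β + 1) (n - 1) *
      poch (α + β + N + 1) (n - 1))

noncomputable def hahnB3 (n N : ℕ) (α β : ℝ) : ℂ :=
  pFq [1 - n, 1, 1 - n - β, 1 - n - α - β - N, 2 - n - (α + β + 1) / 2]
    [1 - n - α, 2 - n - (α + β + 3) / 2, 1 - n - α - β, 1 - n + N] (-1)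

noncomputable def hahnC1 (n N : ℕ) (α β : ℝ) : ℝ :=
  2 * (-1) ^ n * ((n - 1).factorial : ℝ) ^ 2 * (β + 1) * (α + β + N + 1) *
      poch (-α - β - n - N) (n - 1) /
    (poch (α + β + n + 2) (n - 1) ^ 2 * poch (-α - β - n - 1) (n - 1) ^ 2 * (α + β + 2) ^ 2)

open Real in
noncomputable def hahnC2 (n N : ℕ) (α β : ℝ) : ℝ :=
  poch (β + 2) (n - 1) * (1 - N) * (α + 1) * poch (-α - n) (n - 1) * poch (2 - N) (n - 1) *
      (α + β + 2 * n + 1) /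
    ((n.factorial : ℝ) * (-N - β) ^ 2 * Gamma (α + β + 2))

/-- The upper parameters of the `3F2` in the third factor of the middle term. -/
noncomputable def hahnCUpper (n : ℕ) (α β : ℝ) : List ℝ :=
  [1, (α + β + 3) / 2 + n, α + β + n + 1]

/-- The lower parameters of the `3F2` in the third factor of the middle term. -/
noncomputable def hahnCLower (n : ℕ) (α β : ℝ) : List ℝ :=
  [n + 1, (α + β + 1) / 2 + n]

open Real in
noncomputable def hahnC3 (n : ℕ) (α β : ℝ) : ℂ :=
  (Gamma (α + β + n + 1) : ℂ) * pFq (hahnCUpper n α β) (hahnCLower n α β) (-1)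

noncomputable def hahnD1 (n N : ℕ) (α β : ℝ) : ℝ :=
  (((n - 1).factorial : ℝ) * (N - 1) * (α + 1) * poch (-α - n) (n - 1) * poch (-N + 2) (n - 1) /
    (poch (α + β + n + 2) (n - 1) * poch (-α - β - n - 1) (n - 1) * (α + β + 2) * (N + β))) ^ 2

noncomputable def hahnD2 (n N : ℕ) (α β : ℝ) : ℝ :=
  (-1) ^ (n - 1) * poch ((α + β + 3) / 2) (n - 1) * poch (β + 1) (n - 1) *
      poch (α + β + N + 1) (n - 1) * poch (α + β + 1) (n - 1) /
    (((n - 1).factorial : ℝ) * poch (1 - N) (n - 1) * poch (α + 1) (n - 1) *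
      poch ((α + β + 1) / 2) (n - 1))

noncomputable def hahnD3 (n N : ℕ) (α β : ℝ) : ℂ :=
  pFq [1 - n, 1, 1 - n + N, 1 - n - α, 2 - n - (α + β + 1) / 2]
    [2 - n - (α + β + 3) / 2, 1 - n - β, 1 - n - α - β - N, 1 - n - α - β] (-1)

/-!
Let `ω` be the Hahn weight, `R_k` the Hahn polynomials with cleared denominators (`hahnSeries`),
`η_k` their squared norms and `s = α + β`. The forward difference `g = R_n(x+1) - R_n(x)` has degree
`n - 1`. The Pearson equation of `ω` allows a summation by parts, which shows that `g` is orthogonal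
to the multiples of `(N - 1 - x) (x + β + 1)` of degree at most `n`. Hence `⟨g, p⟩` depends only on
the values of `p` at the two zeros `P = N - 1` and `B = -β - 1` (`discreteBilin_taylor_sub_eq`).
Taking `p = R_n` and `p = R_{n-1}` determines the dependence: `⟨g, p⟩` is a constant times
`R_n(B) p(P) - R_n(P) p(B)` (`discreteBilin_taylor_sub_hahnSeries`).

By Parseval's identity `⟨g, g⟩ = ∑_{k<n} ⟨g, R_k⟩² / η_k`. Expanding the square leaves the three
sums `∑_{k<n} R_k(y) R_k(z) / η_k` with `y, z ∈ {P, B}`. At both points the hypergeometric series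
of `R_k` is summed by the Chu-Vandermonde identity, because `-x` cancels a denominator parameter.
The same identity yields the orthogonality of the `R_k` and the norms `η_k`, through the mixed
moments `sum_hahnWeight_mul_poch_mul_poch`.

The sums at `(P, P)` and `(B, B)`, read backwards, are the two `5F4`
(`mul_pFq_eq_sum_kernelCoeff`). The summands of the mixed sum are
`(-1)^k (s+1)_k (s+2k+1) / ((s+1) k!)`. These are, up to the factor `s + 1`, the terms at `z = -1`
of the Taylor series of `(s+1) (1+z) / (1-z)^(s+2)`, and the `3F2` is a multiple of the tail of
that series from `z^n` on, divided by `z^n`. It therefore continues to the cut plane, and since the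
generating function vanishes at `-1`, its value there is minus the partial sum, up to normalization
(`exists_isHypergeometricFunction_hahnC`).
-/

/-! ### Pochhammer symbols -/

theorem poch_zero (a : ℝ) : poch a 0 = 1 := by simp [poch]

theorem poch_succ (a : ℝ) (k : ℕ) : poch a (k + 1) = poch a k * (a + k) := by
  simp [poch, ascPochhammer_succ_eval]

theorem poch_add (a : ℝ) (m n : ℕ) : poch a (m + n) = poch a m * poch (a + m) n := by
  induction n with
  | zero => simp [poch_zero]
  | succ n ih => rw [← add_assoc, poch_succ, poch_succ, ih]; push_cast; ring

theorem poch_succ_left (a : ℝ) (k : ℕ) : poch a (k + 1) = a * poch (a + 1) k := by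
  rw [add_comm k 1, poch_add, poch_succ, poch_zero]; simp

theorem poch_pos {a : ℝ} (ha : 0 < a) (k : ℕ) : 0 < poch a k := ascPochhammer_pos k a ha

theorem poch_ne_zero {a : ℝ} {k : ℕ} (h : ∀ i < k, a + i ≠ 0) : poch a k ≠ 0 := by
  induction k with
  | zero => simp [poch_zero]
  | succ k ih =>
    rw [poch_succ]
    exact mul_ne_zero (ih fun i hi => h i (by omega)) (h k (by omega))

theorem poch_one (k : ℕ) : poch 1 k = k.factorial := by
  simp [poch, ascPochhammer_eval_one]

theorem neg_one_pow_mul_self (m : ℕ) : ((-1 : ℝ) ^ m) * (-1) ^ m = 1 := by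
  rw [← mul_pow]; simp

/-- Reading the product `(a)_k` backwards. -/
theorem poch_reflect {a b : ℝ} {k : ℕ} (h : b = 1 - a - k) : poch b k = (-1) ^ k * poch a k := by
  subst h
  induction k generalizing a with
  | zero => simp [poch_zero]
  | succ k ih =>
    rw [poch_succ_left, poch_succ, pow_succ]
    have := @ih a
    rw [show (1 - a - ((k + 1 : ℕ) : ℝ) + 1) = 1 - a - k by push_cast; ring, this]
    push_cast; ring

/-- Cutting off the first factors of `(a)_m` by a reflected Pochhammer symbol. -/
theorem poch_sub_mul_reflect {a b : ℝ} {m j : ℕ} (hj : j ≤ m) (h : b = 1 - a - m) :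
    poch a (m - j) * poch b j = (-1) ^ j * poch a m := by
  obtain ⟨i, rfl⟩ := Nat.exists_eq_add_of_le hj
  rw [Nat.add_sub_cancel_left, add_comm j i, poch_add,
    poch_reflect (a := a + i) (b := b) (k := j) (by rw [h]; push_cast; ring)]
  ring

theorem poch_neg_natCast_of_lt {m k : ℕ} (h : m < k) : poch (-(m : ℝ)) k = 0 :=
  ascPochhammer_eval_neg_coe_nat_of_lt h

theorem poch_neg_natCast_mul_factorial {m k : ℕ} (h : k ≤ m) :
    poch (-(m : ℝ)) k * ((m - k).factorial : ℝ) = (-1) ^ k * (m.factorial : ℝ) := by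
  have := poch_sub_mul_reflect (a := 1) (b := -(m : ℝ)) h (by ring)
  rw [poch_one, poch_one] at this
  rw [← this]; ring

theorem Gamma_add_natCast_eq_poch {a : ℝ} (ha : 0 < a) (k : ℕ) :
    Real.Gamma (a + k) = Real.Gamma a * poch a k := by
  induction k with
  | zero => simp [poch_zero]
  | succ k ih =>
    rw [poch_succ]
    push_cast
    rw [← add_assoc, Real.Gamma_add_one (by positivity), ih]
    ring

/-- The Chu-Vandermonde convolution. -/
theorem sum_choose_mul_poch_mul_poch (a b : ℝ) (n : ℕ) :
    ∑ i ∈ Finset.range (n + 1), (n.choose i : ℝ) * poch a i * poch b (n - i) = poch (a + b) n := by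
  rw [← Finset.Nat.sum_antidiagonal_eq_sum_range_succ
    (fun i j => (n.choose i : ℝ) * poch a i * poch b j)]
  induction n with
  | zero => simp [poch_zero]
  | succ n ih =>
    simp only [mul_assoc]
    rw [Finset.sum_antidiagonal_choose_succ_mul (fun i j => poch a i * poch b j), poch_succ, ← ih,
      ← Finset.sum_add_distrib, Finset.sum_mul]
    refine Finset.sum_congr rfl fun p hp => ?_
    have hn : (n : ℝ) = p.1 + p.2 := by
      exact_mod_cast (Finset.HasAntidiagonal.mem_antidiagonal.1 hp).symm
    have hc : (n.choose p.2 : ℝ) = n.choose p.1 := by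
      rw [Nat.choose_symm_of_eq_add (Finset.HasAntidiagonal.mem_antidiagonal.1 hp).symm]
    rw [poch_succ, poch_succ, hn, hc]
    ring

/-- Gauss' evaluation of the terminating `2F1(-k, b; c | 1)`, with the denominator `(c)_k`
cleared. -/
theorem sum_neg_one_pow_choose_mul_poch (b c : ℝ) (k : ℕ) :
    ∑ j ∈ Finset.range (k + 1), (-1) ^ j * (k.choose j : ℝ) * poch b j * poch (c + j) (k - j) =
      poch (c - b) k := by
  rw [poch_reflect (a := b + (1 - c - k)) (by ring), ← sum_choose_mul_poch_mul_poch, Finset.mul_sum]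
  refine Finset.sum_congr rfl fun j hj => ?_
  have hj' : j ≤ k := Nat.lt_succ_iff.1 (Finset.mem_range.1 hj)
  obtain ⟨i, rfl⟩ := Nat.exists_eq_add_of_le hj'
  rw [Nat.add_sub_cancel_left, poch_reflect (a := 1 - c - ((j + i : ℕ) : ℝ)) (b := c + j)
    (by push_cast; ring), pow_add]
  have := neg_one_pow_mul_self i
  ring

/-! ### Orthogonality with respect to a discrete weight -/

/-- `discreteForm` as a bilinear map. -/
noncomputable def discreteBilin (ω : ℕ → ℝ) (N : ℕ) : ℝ[X] →ₗ[ℝ] ℝ[X] →ₗ[ℝ] ℝ :=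
  LinearMap.mk₂ ℝ (discreteForm ω N)
    (fun p p' q => by
      simp only [discreteForm, eval_add, ← Finset.sum_add_distrib]
      exact Finset.sum_congr rfl fun x _ => by ring)
    (fun c p q => by
      simp only [discreteForm, eval_smul, smul_eq_mul, Finset.mul_sum]
      exact Finset.sum_congr rfl fun x _ => by ring)
    (fun p q q' => by
      simp only [discreteForm, eval_add, ← Finset.sum_add_distrib]
      exact Finset.sum_congr rfl fun x _ => by ring)
    (fun c p q => by
      simp only [discreteForm, eval_smul, smul_eq_mul, Finset.mul_sum]
      exact Finset.sum_congr rfl fun x _ => by ring)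

theorem discreteBilin_apply (ω : ℕ → ℝ) (N : ℕ) (p q : ℝ[X]) :
    discreteBilin ω N p q = ∑ x ∈ Finset.range N, ω x * p.eval (x : ℝ) * q.eval (x : ℝ) := rfl

theorem discreteBilin_comm (ω : ℕ → ℝ) (N : ℕ) (p q : ℝ[X]) :
    discreteBilin ω N p q = discreteBilin ω N q p := by
  simp only [discreteBilin_apply]
  exact Finset.sum_congr rfl fun x _ => by ring

/-- A linear functional on polynomials that kills one polynomial of each degree below `n` kills
every polynomial of degree below `n`. -/
theorem eq_zero_of_degree_lt_of_sequence (φ : ℝ[X] →ₗ[ℝ] ℝ) {S : ℕ → ℝ[X]}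
    (hS : ∀ k, (S k).degree = k) {n : ℕ} (h : ∀ k < n, φ (S k) = 0) {q : ℝ[X]}
    (hq : q.degree < n) : φ q = 0 := by
  let T : Polynomial.Sequence ℝ := ⟨S, hS⟩
  have hT : Submodule.span ℝ (S '' Set.Iio n) = degreeLT ℝ n :=
    T.span_degreeLT fun i _ => (leadingCoeff_ne_zero.2 (T.ne_zero i)).isUnit
  have hq' : q ∈ Submodule.span ℝ (S '' Set.Iio n) := by rw [hT]; exact mem_degreeLT.2 hq
  have hle : Submodule.span ℝ (S '' Set.Iio n) ≤ LinearMap.ker φ := by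
    rw [Submodule.span_le]
    rintro _ ⟨k, hk, rfl⟩
    exact h k hk
  exact hle hq'

theorem eq_zero_of_discreteBilin_self {ω : ℕ → ℝ} {N : ℕ} (hω : ∀ x < N, 0 < ω x) {p : ℝ[X]}
    (hp : p.degree < N) (h : discreteBilin ω N p p = 0) : p = 0 := by
  by_contra h0
  exact (discreteForm_self_pos hω h0 ((natDegree_lt_iff_degree_lt h0).2 hp)).ne' h

/-- A polynomial of degree `n` orthogonal to all lower degrees is a multiple of the monic
orthogonal polynomial. -/
theorem eq_C_mul_monicOrthogonal {ω : ℕ → ℝ} {N n : ℕ} (hω : ∀ x < N, 0 < ω x) (hn : n < N)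
    {p : ℝ[X]} (hp : p.degree = n)
    (horth : ∀ q : ℝ[X], q.degree < n → discreteBilin ω N p q = 0) :
    p = C p.leadingCoeff * monicOrthogonal ω N n := by
  obtain ⟨hmonic, hdeg⟩ := monicOrthogonal_monic_degree ω N n
  set h := monicOrthogonal ω N n with hh
  have hp0 : p ≠ 0 := by rintro rfl; simp at hp
  have hlc : p.leadingCoeff ≠ 0 := leadingCoeff_ne_zero.2 hp0
  have hlt : (p - C p.leadingCoeff * h).degree < n := by
    rw [← hp]
    refine degree_sub_lt_left ?_ hp0 ?_
    · rw [degree_C_mul hlc, hdeg, hp]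
    · rw [leadingCoeff_mul, hmonic.leadingCoeff, leadingCoeff_C, mul_one]
  have horth' : ∀ q : ℝ[X], q.degree < n → discreteBilin ω N h q = 0 := fun q hq =>
    eq_zero_of_degree_lt_of_sequence (discreteBilin ω N h)
      (fun k => (monicOrthogonal_monic_degree ω N k).2)
      (fun k hk => monicOrthogonal_orthogonal hω n hn k hk) hq
  refine sub_eq_zero.1 (eq_zero_of_discreteBilin_self hω (hlt.trans (by exact_mod_cast hn)) ?_)
  rw [LinearMap.map_sub₂, horth _ hlt, ← smul_eq_C_mul, map_smul, LinearMap.smul_apply,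
    horth' _ (by rw [smul_eq_C_mul]; exact hlt)]
  simp

/-- Parseval's identity for an orthogonal system of polynomials of degrees `0, …, n-1`. -/
theorem discreteBilin_self_eq_sum {ω : ℕ → ℝ} {N n : ℕ} (hω : ∀ x < N, 0 < ω x) (hn : n ≤ N)
    {R : ℕ → ℝ[X]} (hR : ∀ k < n, (R k).degree = k)
    (horth : ∀ k < n, ∀ q : ℝ[X], q.degree < k → discreteBilin ω N (R k) q = 0)
    {q : ℝ[X]} (hq : q.degree < n) :
    discreteBilin ω N q q =
      ∑ k ∈ Finset.range n, discreteBilin ω N q (R k) ^ 2 / discreteBilin ω N (R k) (R k) := by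
  have hpos : ∀ k < n, discreteBilin ω N (R k) (R k) ≠ 0 := fun k hk h => by
    have := eq_zero_of_discreteBilin_self hω
      (by rw [hR k hk]; exact_mod_cast hk.trans_le hn) h
    have h2 := hR k hk
    rw [this] at h2
    simp at h2
  have horth2 : ∀ j < n, ∀ k < n, j ≠ k → discreteBilin ω N (R j) (R k) = 0 := by
    intro j hj k hk hjk
    rcases lt_or_gt_of_ne hjk with h | h
    · rw [discreteBilin_comm]
      exact horth k hk _ (by rw [hR j hj]; exact_mod_cast h)
    · exact horth j hj _ (by rw [hR k hk]; exact_mod_cast h)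
  let S : ℕ → ℝ[X] := fun k => if k < n then R k else X ^ k
  have hS : ∀ k, (S k).degree = k := fun k => by
    by_cases hk : k < n
    · simp [S, hk, hR]
    · simp [S, hk]
  have key : discreteBilin ω N (q - ∑ k ∈ Finset.range n,
      (discreteBilin ω N q (R k) / discreteBilin ω N (R k) (R k)) • R k) q = 0 := by
    refine eq_zero_of_degree_lt_of_sequence _ hS (fun j hj => ?_) hq
    simp only [S, hj, if_true, map_sub, map_sum, map_smul, LinearMap.sub_apply,
      LinearMap.sum_apply, LinearMap.smul_apply, smul_eq_mul]
    rw [Finset.sum_eq_single j, div_mul_cancel₀ _ (hpos j hj), sub_self]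
    · intro k hk hkj
      rw [horth2 k (Finset.mem_range.1 hk) j hj hkj, mul_zero]
    · intro h
      exact absurd (Finset.mem_range.2 hj) h
  rw [map_sub, LinearMap.sub_apply, sub_eq_zero] at key
  rw [key]
  simp only [map_sum, map_smul, LinearMap.sum_apply, LinearMap.smul_apply, smul_eq_mul]
  refine Finset.sum_congr rfl fun k _ => ?_
  rw [discreteBilin_comm ω N (R k) q]
  ring

/-! ### The hypergeometric form of the Hahn polynomials -/

/-- The polynomial `x ↦ (a - x)_k`. -/
noncomputable def shiftedPoch (a : ℝ) (k : ℕ) : ℝ[X] := (ascPochhammer ℝ k).comp (C a - X)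

theorem eval_shiftedPoch (a : ℝ) (k : ℕ) (x : ℝ) : (shiftedPoch a k).eval x = poch (a - x) k := by
  simp [shiftedPoch, poch]

theorem natDegree_C_sub_X (a : ℝ) : (C a - X : ℝ[X]).natDegree = 1 := by
  rw [natDegree_sub, natDegree_X_sub_C]

theorem leadingCoeff_shiftedPoch (a : ℝ) (k : ℕ) :
    (shiftedPoch a k).leadingCoeff = (-1) ^ k := by
  rw [shiftedPoch, leadingCoeff_comp (by rw [natDegree_C_sub_X]; exact one_ne_zero),
    ascPochhammer_natDegree, (monic_ascPochhammer ℝ k).leadingCoeff, one_mul,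
    leadingCoeff, natDegree_C_sub_X]
  simp

theorem degree_shiftedPoch (a : ℝ) (k : ℕ) : (shiftedPoch a k).degree = k := by
  have h0 : shiftedPoch a k ≠ 0 := by
    rw [← leadingCoeff_ne_zero, leadingCoeff_shiftedPoch]
    exact pow_ne_zero _ (by norm_num)
  rw [degree_eq_natDegree h0, shiftedPoch, natDegree_comp, ascPochhammer_natDegree,
    natDegree_C_sub_X, mul_one]

/-- The Hahn polynomial `3F2(-k, α+β+k+1, -x; β+1, 1-N | 1)` multiplied by `(β+1)_k (1-N)_k`, which
clears the denominators. -/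
noncomputable def hahnSeries (N : ℕ) (α β : ℝ) (k : ℕ) : ℝ[X] :=
  ∑ j ∈ Finset.range (k + 1),
    ((-1) ^ j * (k.choose j : ℝ) * poch (α + β + k + 1) j * poch (β + 1 + j) (k - j) *
      poch (1 - N + j) (k - j)) • shiftedPoch 0 j

theorem hahnSeries_degree_leadingCoeff (N : ℕ) {α β : ℝ} (hα : -1 < α) (hβ : -1 < β) (k : ℕ) :
    (hahnSeries N α β k).degree = k ∧
      (hahnSeries N α β k).leadingCoeff = poch (α + β + k + 1) k := by
  have hρ : poch (α + β + k + 1) k ≠ 0 := by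
    refine poch_ne_zero fun i hi => ?_
    have : (1 : ℝ) ≤ k := by exact_mod_cast (by omega : 1 ≤ k)
    have : (0 : ℝ) ≤ i := Nat.cast_nonneg i
    linarith
  have hc : (-1) ^ k * poch (α + β + k + 1) k ≠ 0 :=
    mul_ne_zero (pow_ne_zero _ (by norm_num)) hρ
  have htop : (((-1) ^ k * poch (α + β + k + 1) k) • shiftedPoch 0 k).degree = k := by
    rw [smul_eq_C_mul, degree_C_mul hc, degree_shiftedPoch]
  have hlt : (∑ j ∈ Finset.range k,
      ((-1) ^ j * (k.choose j : ℝ) * poch (α + β + k + 1) j * poch (β + 1 + j) (k - j) *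
        poch (1 - N + j) (k - j)) • shiftedPoch 0 j).degree <
      (((-1) ^ k * poch (α + β + k + 1) k) • shiftedPoch 0 k).degree := by
    rw [htop]
    refine (degree_sum_le _ _).trans_lt ((Finset.sup_lt_iff (WithBot.bot_lt_coe k)).2 ?_)
    intro j hj
    refine (degree_smul_le _ _).trans_lt ?_
    rw [degree_shiftedPoch]
    exact WithBot.coe_lt_coe.2 (Finset.mem_range.1 hj)
  rw [hahnSeries, Finset.sum_range_succ]
  simp only [Nat.sub_self, poch_zero, Nat.choose_self, Nat.cast_one, mul_one]
  refine ⟨by rw [degree_add_eq_right_of_degree_lt hlt, htop], ?_⟩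
  rw [leadingCoeff_add_of_degree_lt hlt, smul_eq_C_mul, leadingCoeff_mul, leadingCoeff_C,
    leadingCoeff_shiftedPoch, mul_right_comm, ← mul_pow]
  simp

theorem hahnSeries_ne_zero (N : ℕ) {α β : ℝ} (hα : -1 < α) (hβ : -1 < β) (k : ℕ) :
    hahnSeries N α β k ≠ 0 := fun h => by
  have := (hahnSeries_degree_leadingCoeff N hα hβ k).1
  rw [h] at this
  simp at this

theorem eval_hahnSeries (N : ℕ) (α β : ℝ) (k : ℕ) (x : ℝ) :
    (hahnSeries N α β k).eval x = ∑ j ∈ Finset.range (k + 1),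
      (-1) ^ j * (k.choose j : ℝ) * poch (α + β + k + 1) j * poch (β + 1 + j) (k - j) *
        poch (1 - N + j) (k - j) * poch (-x) j := by
  simp [hahnSeries, eval_finsetSum, eval_shiftedPoch]

/-- At `x = N - 1` the numerator parameter `-x` cancels the denominator parameter `1 - N`. -/
theorem eval_hahnSeries_right (N : ℕ) (α β : ℝ) (k : ℕ) :
    (hahnSeries N α β k).eval (N - 1 : ℝ) = (-1) ^ k * poch (1 - N) k * poch (α + 1) k := by
  have h := sum_neg_one_pow_choose_mul_poch (α + β + k + 1) (β + 1) k
  rw [poch_reflect (a := α + 1) (b := β + 1 - (α + β + k + 1)) (by ring)] at h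
  rw [eval_hahnSeries, mul_right_comm, ← h, Finset.sum_mul]
  refine Finset.sum_congr rfl fun j hj => ?_
  obtain ⟨i, rfl⟩ := Nat.exists_eq_add_of_le (Nat.lt_succ_iff.1 (Finset.mem_range.1 hj))
  rw [Nat.add_sub_cancel_left, poch_add (1 - N : ℝ), neg_sub]
  ring

/-- At `x = -β - 1` the numerator parameter `-x` cancels the denominator parameter `β + 1`. -/
theorem eval_hahnSeries_left (N : ℕ) (α β : ℝ) (k : ℕ) :
    (hahnSeries N α β k).eval (-β - 1) =
      (-1) ^ k * poch (β + 1) k * poch (α + β + N + 1) k := by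
  have h := sum_neg_one_pow_choose_mul_poch (α + β + k + 1) (1 - N) k
  rw [poch_reflect (a := α + β + N + 1) (b := 1 - N - (α + β + k + 1)) (by ring)] at h
  rw [eval_hahnSeries, mul_right_comm, ← h, Finset.sum_mul]
  refine Finset.sum_congr rfl fun j hj => ?_
  obtain ⟨i, rfl⟩ := Nat.exists_eq_add_of_le (Nat.lt_succ_iff.1 (Finset.mem_range.1 hj))
  rw [Nat.add_sub_cancel_left, poch_add (β + 1), show -(-β - 1) = β + 1 by ring]
  ring

/-- The mixed moments of the Hahn weight on `{0, …, L}`. Both `(-x)_j` and `(L+1+α-x)_m` merge with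
the weight, so that the moment is the total mass of a Hahn weight with shifted parameters. -/
theorem sum_hahnWeight_mul_poch_mul_poch {α β : ℝ} (hα : -1 < α) (hβ : -1 < β) {L j : ℕ}
    (hj : j ≤ L) (m : ℕ) :
    ∑ x ∈ Finset.range (L + 1), hahnWeight (L + 1) α β x * poch (-x) j * poch (L + 1 + α - x) m =
      Real.Gamma (α + 1 + m) * Real.Gamma (β + 1) * poch (β + 1) j * poch (-L) j /
        L.factorial * poch (α + β + m + 2 + j) (L - j) := by
  obtain ⟨M, rfl⟩ := Nat.exists_eq_add_of_le hj
  have hM := poch_neg_natCast_mul_factorial (Nat.le_add_right j M)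
  rw [Nat.add_sub_cancel_left] at hM ⊢
  have hMf : (M.factorial : ℝ) ≠ 0 := by positivity
  have hLf : ((j + M).factorial : ℝ) ≠ 0 := by positivity
  rw [add_assoc j M 1, Finset.sum_range_add, Finset.sum_eq_zero, zero_add]
  · have hV := sum_choose_mul_poch_mul_poch (β + 1 + j) (α + 1 + m) M
    rw [show β + 1 + j + (α + 1 + m) = α + β + m + 2 + j by ring] at hV
    rw [← hV, Finset.mul_sum]
    refine Finset.sum_congr rfl fun y hy => ?_
    obtain ⟨z, rfl⟩ := Nat.exists_eq_add_of_le (Nat.lt_succ_iff.1 (Finset.mem_range.1 hy))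
    have hy' := poch_neg_natCast_mul_factorial (Nat.le_add_right j y)
    rw [Nat.add_sub_cancel_left] at hy' ⊢
    have hc : ((y + z).choose y : ℝ) = (y + z).factorial / (y.factorial * z.factorial) := by
      rw [Nat.cast_add_choose]
    have hG1 : Real.Gamma (α + 1 + z) * poch (α + 1 + z) m =
        Real.Gamma (α + 1 + m) * poch (α + 1 + m) z := by
      rw [← Gamma_add_natCast_eq_poch (by linarith [Nat.cast_nonneg (α := ℝ) z]),
        ← Gamma_add_natCast_eq_poch (by linarith [Nat.cast_nonneg (α := ℝ) m]), add_right_comm]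
    have hG2 : Real.Gamma (β + 1 + (j + y : ℕ)) =
        Real.Gamma (β + 1) * (poch (β + 1) j * poch (β + 1 + j) y) := by
      rw [Gamma_add_natCast_eq_poch (by linarith), poch_add]
    have hw : hahnWeight (j + (y + z + 1)) α β (j + y) = Real.Gamma (α + 1 + z) *
        Real.Gamma (β + 1 + (j + y : ℕ)) / (z.factorial * (j + y).factorial) := by
      rw [hahnWeight, show j + (y + z + 1) - (j + y) - 1 = z by omega]
      congr 3 <;> push_cast <;> ring_nf
    have hyf : (y.factorial : ℝ) ≠ 0 := by positivity
    have hzf : (z.factorial : ℝ) ≠ 0 := by positivity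
    have hjyf : ((j + y).factorial : ℝ) ≠ 0 := by positivity
    rw [hw, hG2, hc, eq_div_of_mul_eq hMf hM, eq_div_of_mul_eq hyf hy',
      show ((j + (y + z) : ℕ) : ℝ) + 1 + α - (j + y : ℕ) = α + 1 + z by push_cast; ring]
    field_simp
    linear_combination (Real.Gamma (β + 1) * poch (β + 1) j * poch (β + 1 + j) y) * hG1
  · intro x hx
    rw [poch_neg_natCast_of_lt (Finset.mem_range.1 hx)]
    ring

theorem discreteBilin_hahnSeries_shiftedPoch {α β : ℝ} (hα : -1 < α) (hβ : -1 < β) {L k : ℕ}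
    (hk : k ≤ L) (m : ℕ) :
    discreteBilin (hahnWeight (L + 1) α β) (L + 1) (hahnSeries (L + 1) α β k)
        (shiftedPoch (L + 1 + α) m) =
      Real.Gamma (α + 1 + m) * Real.Gamma (β + 1) * poch (β + 1) k * poch (-L) k /
        L.factorial * poch (α + β + m + 2 + k) (L - k) * poch (m + 1 - k) k := by
  have hL : (1 : ℝ) - (L + 1 : ℕ) = -L := by push_cast; ring
  have h := sum_neg_one_pow_choose_mul_poch (α + β + k + 1) (α + β + m + 2) k
  rw [show α + β + m + 2 - (α + β + k + 1) = m + 1 - k by ring] at h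
  rw [hahnSeries, LinearMap.map_sum₂, ← h, Finset.mul_sum]
  refine Finset.sum_congr rfl fun j hj => ?_
  have hj' := Nat.lt_succ_iff.1 (Finset.mem_range.1 hj)
  have hmom := sum_hahnWeight_mul_poch_mul_poch hα hβ (hj'.trans hk) m
  rw [LinearMap.map_smul₂, discreteBilin_apply]
  simp only [eval_shiftedPoch, zero_sub]
  rw [hmom, hL, smul_eq_mul]
  obtain ⟨i, rfl⟩ := Nat.exists_eq_add_of_le hj'
  obtain ⟨M, rfl⟩ := Nat.exists_eq_add_of_le hk
  rw [Nat.add_sub_cancel_left, Nat.add_sub_cancel_left, show j + i + M - j = i + M by omega,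
    poch_add (α + β + m + 2 + j), poch_add (β + 1) j i, poch_add (-((j + i + M : ℕ) : ℝ)) j i]
  push_cast
  rw [show α + β + m + 2 + (j + i) = α + β + m + 2 + j + (i : ℝ) by ring]
  ring

theorem discreteBilin_hahnSeries_of_degree_lt {α β : ℝ} (hα : -1 < α) (hβ : -1 < β) {N k : ℕ}
    (hk : k < N) {q : ℝ[X]} (hq : q.degree < k) :
    discreteBilin (hahnWeight N α β) N (hahnSeries N α β k) q = 0 := by
  obtain ⟨L, rfl⟩ : ∃ L, N = L + 1 := ⟨N - 1, by omega⟩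
  refine eq_zero_of_degree_lt_of_sequence _ (degree_shiftedPoch (L + 1 + α)) (fun m hm => ?_) hq
  rw [discreteBilin_hahnSeries_shiftedPoch hα hβ (by omega)]
  have : poch (m + 1 - k) k = 0 := by
    obtain ⟨i, rfl⟩ : ∃ i, k = m + 1 + i := ⟨k - (m + 1), by omega⟩
    rw [show (m : ℝ) + 1 - (m + 1 + i : ℕ) = -(i : ℝ) by push_cast; ring]
    exact poch_neg_natCast_of_lt (by omega)
  rw [this, mul_zero]

/-- Only the leading coefficient of the second argument contributes to the pairing with the Hahn
polynomial of the same degree. -/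
theorem discreteBilin_hahnSeries_of_degree_eq {α β : ℝ} (hα : -1 < α) (hβ : -1 < β) {N k : ℕ}
    (hk : k < N) {q : ℝ[X]} {c : ℝ} (hq : (q - c • hahnSeries N α β k).degree < k) :
    discreteBilin (hahnWeight N α β) N (hahnSeries N α β k) q =
      c * discreteBilin (hahnWeight N α β) N (hahnSeries N α β k) (hahnSeries N α β k) := by
  have := discreteBilin_hahnSeries_of_degree_lt hα hβ hk hq
  rw [map_sub, map_smul, sub_eq_zero] at this
  exact this

theorem poch_one_sub_natCast_ne_zero {N k : ℕ} (hk : k < N) : poch (1 - N) k ≠ 0 := by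
  refine poch_ne_zero fun i hi h => ?_
  have : (i : ℝ) + 1 < N := by exact_mod_cast (by omega : i + 1 < N)
  linarith

/-- The total mass `Γ(α+1) Γ(β+1) (α+β+2)_{N-1} / (N-1)!` of the Hahn weight. -/
noncomputable def hahnMass (N : ℕ) (α β : ℝ) : ℝ :=
  Real.Gamma (α + 1) * Real.Gamma (β + 1) * poch (α + β + 2) (N - 1) / (N - 1).factorial

/-- The squared norm of the Hahn polynomials; the factors on the left clear its denominators. -/
theorem discreteBilin_hahnSeries_self {α β : ℝ} (hα : -1 < α) (hβ : -1 < β) {N k : ℕ}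
    (hk : k < N) :
    discreteBilin (hahnWeight N α β) N (hahnSeries N α β k) (hahnSeries N α β k) *
        (poch (α + β + 1) k * (α + β + 2 * k + 1)) =
      (-1) ^ k * hahnMass N α β * (α + β + 1) * k.factorial *
        (poch (α + 1) k * poch (β + 1) k * poch (1 - N) k * poch (α + β + N + 1) k) := by
  obtain ⟨L, rfl⟩ : ∃ L, N = L + 1 := ⟨N - 1, by omega⟩
  have hkL : k ≤ L := by omega
  obtain ⟨hdeg, hlead⟩ := hahnSeries_degree_leadingCoeff (L + 1) hα hβ k
  have h1 := discreteBilin_hahnSeries_shiftedPoch hα hβ hkL k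
  set R := hahnSeries (L + 1) α β k with hR
  set ρ := poch (α + β + k + 1) k with hρ
  have hρ0 : ρ ≠ 0 := by rw [← hlead]; exact leadingCoeff_ne_zero.2 (hahnSeries_ne_zero _ hα hβ k)
  have hc : (-1 : ℝ) ^ k / ρ ≠ 0 := div_ne_zero (pow_ne_zero _ (by norm_num)) hρ0
  have hlt : (shiftedPoch (L + 1 + α) k - ((-1) ^ k / ρ) • R).degree < k := by
    conv_rhs => rw [← degree_shiftedPoch (L + 1 + α) k]
    refine degree_sub_lt_left ?_ ?_ ?_
    · rw [smul_eq_C_mul, degree_C_mul hc, hdeg, degree_shiftedPoch]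
    · rw [← leadingCoeff_ne_zero, leadingCoeff_shiftedPoch]
      exact pow_ne_zero _ (by norm_num)
    · rw [smul_eq_C_mul, leadingCoeff_mul, leadingCoeff_C, hlead, leadingCoeff_shiftedPoch,
        div_mul_cancel₀ _ hρ0]
  rw [discreteBilin_hahnSeries_of_degree_eq hα hβ (by omega) hlt] at h1
  rw [← hR, Gamma_add_natCast_eq_poch (by linarith),
    show (k : ℝ) + 1 - k = 1 by ring, poch_one] at h1
  -- Both sides of the next identity are `(α+β+1)_{L+k+1}`, split in two different ways.
  have h2 : poch (α + β + 1) k * (ρ * ((α + β + 2 * k + 1) * poch (α + β + k + 2 + k) (L - k))) =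
      (α + β + 1) * (poch (α + β + 2) L * poch (α + β + (L + 1) + 1) k) := by
    have e1 := poch_add (α + β + 1) k (L + 1)
    have e2 := poch_succ_left (α + β + 1) (k + L)
    have e3 := poch_add (α + β + 2) L k
    have e4 := poch_add (α + β + k + 1) k (L - k + 1)
    have e5 := poch_succ_left (α + β + k + 1 + k) (L - k)
    rw [show k + (L - k + 1) = L + 1 by omega] at e4
    rw [show α + β + 1 + 1 = α + β + 2 by ring, add_comm k L, e3] at e2
    rw [show α + β + k + 1 + k + 1 = α + β + k + 2 + (k : ℝ) by ring] at e5
    rw [show α + β + 1 + k = α + β + k + 1 by ring, e4, e5, show k + (L + 1) = L + k + 1 by ring,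
      e2] at e1
    rw [show α + β + (L + 1) + 1 = α + β + 2 + (L : ℝ) by ring, e1, hρ]
    ring
  have hε := neg_one_pow_mul_self k
  have h3 : discreteBilin (hahnWeight (L + 1) α β) (L + 1) R R = (-1) ^ k * ρ *
      (Real.Gamma (α + 1) * poch (α + 1) k * Real.Gamma (β + 1) * poch (β + 1) k * poch (-L) k /
        L.factorial * poch (α + β + k + 2 + k) (L - k) * k.factorial) := by
    rw [← h1]
    field_simp
    linear_combination (-discreteBilin (hahnWeight (L + 1) α β) (L + 1) R R) * hε
  rw [h3, hahnMass, Nat.add_sub_cancel]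
  push_cast
  rw [show (1 : ℝ) - (L + 1) = -L by ring]
  linear_combination ((-1) ^ k * (Real.Gamma (α + 1) * poch (α + 1) k * Real.Gamma (β + 1) *
    poch (β + 1) k * poch (-L) k / L.factorial * k.factorial)) * h2

theorem hahnMass_pos {α β : ℝ} (hα : -1 < α) (hβ : -1 < β) (N : ℕ) : 0 < hahnMass N α β := by
  have h1 := Real.Gamma_pos_of_pos (show 0 < α + 1 by linarith)
  have h2 := Real.Gamma_pos_of_pos (show 0 < β + 1 by linarith)
  have h3 := poch_pos (show 0 < α + β + 2 by linarith) (N - 1)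
  unfold hahnMass
  positivity

/-! ### Differences of orthogonal polynomials -/

theorem coeff_taylor_one_sub {p : ℝ[X]} {m : ℕ} (hp : p.natDegree ≤ m + 1) :
    (taylor 1 p - p).coeff m = (m + 1) * p.coeff (m + 1) := by
  have hdeg : (hasseDeriv m p).natDegree < 2 :=
    (natDegree_hasseDeriv_le p m).trans_lt (by omega)
  rw [coeff_sub, taylor_coeff, eval_eq_sum_range' hdeg, Finset.sum_range_succ,
    Finset.sum_range_one, hasseDeriv_coeff, hasseDeriv_coeff]
  rw [zero_add, add_comm 1 m, Nat.choose_self, Nat.choose_succ_self_right]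
  push_cast
  ring

/-- The forward difference lowers the degree by one and multiplies the leading coefficient by the
degree. -/
theorem degree_taylor_one_sub_sub_smul_lt {p q : ℝ[X]} {m : ℕ} (hp : p.degree = (m + 1 : ℕ))
    (hq : q.degree = m) {c : ℝ} (hc : c * q.leadingCoeff = (m + 1) * p.leadingCoeff) :
    (taylor 1 p - p - c • q).degree < m := by
  have hp' := natDegree_eq_of_degree_eq_some hp
  have hq' := natDegree_eq_of_degree_eq_some hq
  rw [degree_lt_iff_coeff_zero]
  intro i hi
  rw [coeff_sub, coeff_taylor_one_sub (by omega), coeff_smul, smul_eq_mul]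
  rcases hi.eq_or_lt with rfl | hi
  · rw [leadingCoeff, leadingCoeff, hp', hq'] at hc
    rw [hc, sub_self]
  · rw [coeff_eq_zero_of_natDegree_lt (by omega : p.natDegree < i + 1),
      coeff_eq_zero_of_natDegree_lt (by omega : q.natDegree < i)]
    ring

theorem degree_taylor_sub_lt (r : ℝ) {p : ℝ[X]} (hp : p ≠ 0) :
    (taylor r p - p).degree < p.degree := by
  rw [← degree_taylor p r]
  refine degree_sub_lt_left (degree_taylor p r) ?_ ?_
  · rwa [Ne, taylor_eq_zero]
  · rw [leadingCoeff, natDegree_taylor, coeff_taylor_natDegree]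

/-- The Pearson difference equation of the Hahn weight. -/
theorem hahnWeight_mul_eq {α : ℝ} (hα : -1 < α) {β : ℝ} (hβ : -1 < β) {N x : ℕ} (hx : x + 1 < N) :
    hahnWeight N α β x * ((N - 1 - x) * (x + (β + 1))) =
      hahnWeight N α β (x + 1) * ((x + 1) * (N + α - (x + 1))) := by
  obtain ⟨M, rfl⟩ : ∃ M, N = x + 2 + M := ⟨N - (x + 2), by omega⟩
  have hM : (0 : ℝ) ≤ M := Nat.cast_nonneg M
  have hx0 : (0 : ℝ) ≤ x := Nat.cast_nonneg x
  rw [hahnWeight, hahnWeight, show x + 2 + M - x - 1 = M + 1 by omega,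
    show x + 2 + M - (x + 1) - 1 = M by omega, Nat.factorial_succ, Nat.factorial_succ]
  push_cast
  rw [show (x : ℝ) + 2 + M + α - x = (M + 1 + α) + 1 by ring,
    show (x : ℝ) + 2 + M + α - (x + 1) = M + 1 + α by ring,
    show β + ((x : ℝ) + 1) + 1 = β + x + 1 + 1 by ring,
    Real.Gamma_add_one (s := M + 1 + α) (by linarith),
    Real.Gamma_add_one (s := β + x + 1) (by linarith)]
  have : (M.factorial : ℝ) ≠ 0 := by positivity
  have : (x.factorial : ℝ) ≠ 0 := by positivity
  field_simp
  ring

/-- Summation by parts against the Hahn weight. -/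
theorem discreteBilin_taylor_sub {α β : ℝ} (hα : -1 < α) (hβ : -1 < β) (N : ℕ) (h q : ℝ[X]) :
    discreteBilin (hahnWeight N α β) N (taylor 1 h - h)
        ((C (N - 1 : ℝ) - X) * (X + C (β + 1)) * q) =
      discreteBilin (hahnWeight N α β) N h
        (X * (C (N + α) - X) * taylor (-1) q - (C (N - 1 : ℝ) - X) * (X + C (β + 1)) * q) := by
  rcases N with _ | L
  · simp [discreteBilin_apply]
  have key : ∑ x ∈ Finset.range (L + 1), hahnWeight (L + 1) α β x *
      ((((L + 1 : ℕ) : ℝ) - 1 - x) * (x + (β + 1))) * (q.eval (x : ℝ) * h.eval ((x : ℝ) + 1)) =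
      ∑ x ∈ Finset.range (L + 1), hahnWeight (L + 1) α β x *
        (x * (((L + 1 : ℕ) : ℝ) + α - x)) * (q.eval ((x : ℝ) - 1) * h.eval (x : ℝ)) := by
    rw [Finset.sum_range_succ, Finset.sum_range_succ']
    simp only [Nat.cast_zero, zero_mul, mul_zero, add_zero]
    rw [show ((L + 1 : ℕ) : ℝ) - 1 - L = 0 by push_cast; ring]
    simp only [zero_mul, mul_zero, add_zero]
    refine Finset.sum_congr rfl fun x hx => ?_
    have hx' := Finset.mem_range.1 hx
    rw [hahnWeight_mul_eq hα hβ (by omega : x + 1 < L + 1)]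
    push_cast
    rw [add_sub_cancel_right]
  simp only [discreteBilin_apply, eval_sub, eval_mul, eval_add, eval_C, eval_X, taylor_eval]
  rw [← sub_eq_zero, ← Finset.sum_sub_distrib]
  rw [← sub_eq_zero, ← Finset.sum_sub_distrib] at key
  rw [← key]
  refine Finset.sum_congr rfl fun x _ => ?_
  rw [← sub_eq_add_neg]
  ring

/-- The quadratic terms cancel in the right-hand side of the summation by parts, so that the degree
increases by one only. -/
theorem degree_parts_lt (α β N : ℝ) (k : ℕ) :
    (X * (C (N + α) - X) * taylor (-1) (X ^ k : ℝ[X]) -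
      (C (N - 1) - X) * (X + C (β + 1)) * X ^ k).degree < ((k + 2 : ℕ) : WithBot ℕ) := by
  have h : X * (C (N + α) - X) * taylor (-1) (X ^ k : ℝ[X]) -
      (C (N - 1) - X) * (X + C (β + 1)) * X ^ k =
      X * (C (N + α) - X) * (taylor (-1) (X ^ k : ℝ[X]) - X ^ k) +
        (C (α + β + 2) * X + C (-(N - 1) * (β + 1))) * X ^ k := by
    simp only [C_add, C_sub, C_mul, C_neg, C_1, C_ofNat]
    ring
  rw [h]
  refine (degree_add_le _ _).trans_lt (max_lt ?_ ?_)
  · have h1 := degree_taylor_sub_lt (-1) (pow_ne_zero k X_ne_zero : (X ^ k : ℝ[X]) ≠ 0)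
    rw [degree_X_pow] at h1
    have h2 : (X * (C (N + α) - X) : ℝ[X]).degree = 2 := by
      rw [degree_mul, degree_X, degree_eq_natDegree, natDegree_C_sub_X]
      · rfl
      · intro h0
        have := natDegree_C_sub_X (N + α)
        rw [h0] at this
        simp at this
    rw [degree_mul, h2]
    calc (2 : WithBot ℕ) + _ < 2 + (k : WithBot ℕ) := WithBot.add_lt_add_left (by simp) h1
      _ = ((k + 2 : ℕ) : WithBot ℕ) := by push_cast; rw [add_comm]
  · rw [degree_mul, degree_X_pow]
    calc _ ≤ (1 : WithBot ℕ) + k := by gcongr; exact degree_linear_le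
      _ = ((1 + k : ℕ) : WithBot ℕ) := by push_cast; rfl
      _ < _ := by exact_mod_cast (by omega : 1 + k < k + 2)

/-- If `h` is orthogonal to all degrees below `n`, then pairing with its forward difference is, in
degrees at most `n`, a combination of the evaluations at the two zeros `N - 1` and `-β - 1` of
`(N - 1 - x) (x + β + 1)`. -/
theorem discreteBilin_taylor_sub_eq {α β : ℝ} (hα : -1 < α) (hβ : -1 < β) {N n : ℕ}
    {h : ℝ[X]} (horth : ∀ q : ℝ[X], q.degree < n → discreteBilin (hahnWeight N α β) N h q = 0)
    {p : ℝ[X]} (hp : p.degree < (n + 1 : ℕ)) :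
    (N + β) * discreteBilin (hahnWeight N α β) N (taylor 1 h - h) p =
      discreteBilin (hahnWeight N α β) N (taylor 1 h - h) (X + C (β + 1)) * p.eval (N - 1 : ℝ) +
        discreteBilin (hahnWeight N α β) N (taylor 1 h - h) (C (N - 1 : ℝ) - X) *
          p.eval (-β - 1) := by
  set B := discreteBilin (hahnWeight N α β) N (taylor 1 h - h) with hB
  let φ : ℝ[X] →ₗ[ℝ] ℝ := ((N : ℝ) + β) • B - (B (X + C (β + 1))) • leval (N - 1 : ℝ) -
    (B (C (N - 1 : ℝ) - X)) • leval (-β - 1)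
  have hφ : ∀ p, φ p = (N + β) * B p - B (X + C (β + 1)) * p.eval (N - 1 : ℝ) -
      B (C (N - 1 : ℝ) - X) * p.eval (-β - 1) := fun p => by simp [φ, leval]
  let S : ℕ → ℝ[X]
    | 0 => 1
    | 1 => X + C (β + 1)
    | k + 2 => (C (N - 1 : ℝ) - X) * (X + C (β + 1)) * X ^ k
  have hS : ∀ k, (S k).degree = k := by
    rintro (_ | _ | k)
    · simp [S]
    · simp only [S, degree_X_add_C]; rfl
    · have h1 : (C (N - 1 : ℝ) - X : ℝ[X]).degree = 1 := by
        rw [← neg_sub, degree_neg, degree_X_sub_C]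
      simp only [S, degree_mul, degree_X_add_C, degree_X_pow, h1]
      push_cast
      rw [add_comm]
      rfl
  have hφp : φ p = 0 := by
    refine eq_zero_of_degree_lt_of_sequence φ hS (fun k hk => ?_) hp
    rw [hφ]
    match k, hk with
    | 0, _ =>
      have h1 : ((N : ℝ) + β) * B 1 = B (X + C (β + 1)) + B (C (N - 1 : ℝ) - X) := by
        rw [← map_add, ← smul_eq_mul, ← map_smul, smul_eq_C_mul]
        congr 1
        simp only [C_add, C_sub, C_1]
        ring
      simp only [S, h1, eval_one]
      ring
    | 1, _ =>
      simp only [S, eval_add, eval_X, eval_C]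
      ring
    | k + 2, hk =>
      have h1 : B ((C (N - 1 : ℝ) - X) * (X + C (β + 1)) * X ^ k) = 0 := by
        rw [hB, discreteBilin_taylor_sub hα hβ]
        exact horth _ ((degree_parts_lt α β N k).trans_le (by exact_mod_cast (by omega)))
      simp only [S, h1, eval_mul, eval_sub, eval_add, eval_C, eval_X]
      ring
  rw [hφ] at hφp
  linear_combination hφp

/-! ### The Fisher information as a sum over the reproducing kernel -/

theorem relativeFisherInformation_eq (ω : ℕ → ℝ) (N : ℕ) (p : ℝ[X]) :
    relativeFisherInformation ω N p =
      discreteBilin ω N (taylor 1 p - p) (taylor 1 p - p) / discreteBilin ω N p p := by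
  rw [relativeFisherInformation, div_mul_eq_mul_div, one_mul]
  simp only [discreteBilin_apply, discreteForm, eval_sub, taylor_eval]
  congr 1
  exact Finset.sum_congr rfl fun x _ => by ring

theorem relativeFisherInformation_C_mul (ω : ℕ → ℝ) (N : ℕ) {c : ℝ} (hc : c ≠ 0) (p : ℝ[X]) :
    relativeFisherInformation ω N (C c * p) = relativeFisherInformation ω N p := by
  have h : taylor 1 (C c * p) - C c * p = c • (taylor 1 p - p) := by
    rw [← smul_eq_C_mul, map_smul, smul_sub]
  rw [relativeFisherInformation_eq, relativeFisherInformation_eq, h, ← smul_eq_C_mul]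
  simp only [map_smul, LinearMap.smul_apply, smul_eq_mul]
  rw [mul_div_mul_left _ _ hc, mul_div_mul_left _ _ hc]

/-- The Fisher information does not depend on the normalization. -/
theorem relativeFisherInformation_hahnPolynomial {α β : ℝ} (hα : -1 < α) (hβ : -1 < β) {n N : ℕ}
    (hnN : n < N) :
    relativeFisherInformation (hahnWeight N α β) N (hahnPolynomial N α β n) =
      relativeFisherInformation (hahnWeight N α β) N (hahnSeries N α β n) := by
  obtain ⟨hdeg, -⟩ := hahnSeries_degree_leadingCoeff N hα hβ n
  have h0 : (hahnSeries N α β n).leadingCoeff ≠ 0 :=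
    leadingCoeff_ne_zero.2 (hahnSeries_ne_zero N hα hβ n)
  conv_rhs => rw [eq_C_mul_monicOrthogonal (fun x hx => hahnWeight_pos hα hβ hx) hnN hdeg
    fun q hq => discreteBilin_hahnSeries_of_degree_lt hα hβ hnN hq]
  rw [relativeFisherInformation_C_mul _ _ h0, hahnPolynomial]

theorem discreteBilin_hahnSeries_self_pos {α β : ℝ} (hα : -1 < α) (hβ : -1 < β) {N k : ℕ}
    (hk : k < N) :
    0 < discreteBilin (hahnWeight N α β) N (hahnSeries N α β k) (hahnSeries N α β k) := by
  obtain ⟨hdeg, -⟩ := hahnSeries_degree_leadingCoeff N hα hβ k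
  refine discreteForm_self_pos (fun x hx => hahnWeight_pos hα hβ hx)
    (hahnSeries_ne_zero N hα hβ k) ?_
  rw [natDegree_eq_of_degree_eq_some hdeg]
  exact hk

theorem poch_add_one_ne_zero {s : ℝ} (hs : -2 < s) (hs1 : s ≠ -1) (k : ℕ) :
    poch (s + 1) k ≠ 0 := by
  refine poch_ne_zero fun i _ => ?_
  rcases i with _ | i
  · intro h
    apply hs1
    simp at h
    linarith
  · have : (0 : ℝ) ≤ i := Nat.cast_nonneg i
    push_cast
    linarith

/-- The pairing of the difference of the Hahn polynomial of degree `m + 1` with polynomials `p` of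
lower degree is a determinant of evaluations at `N - 1` and `-β - 1`. The constant is found by
taking for `p` the Hahn polynomials of degrees `m + 1` and `m`. -/
theorem discreteBilin_taylor_sub_hahnSeries {α β : ℝ} (hα : -1 < α) (hβ : -1 < β)
    (hαβ : α + β ≠ -1) {m N : ℕ} (hN : m + 1 < N) {p : ℝ[X]} (hp : p.degree < (m + 1 : ℕ)) :
    discreteBilin (hahnWeight N α β) N
        (taylor 1 (hahnSeries N α β (m + 1)) - hahnSeries N α β (m + 1)) p =
      (-1) ^ (m + 1) * hahnMass N α β * (m + 1).factorial / (poch (α + β + 2) m * (N + β)) *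
        ((hahnSeries N α β (m + 1)).eval (-β - 1) * p.eval (N - 1 : ℝ) -
          (hahnSeries N α β (m + 1)).eval (N - 1 : ℝ) * p.eval (-β - 1)) := by
  have hNβ : 0 < (N : ℝ) + β := by
    have : (1 : ℝ) ≤ N := by exact_mod_cast (by omega : 1 ≤ N)
    linarith
  have hm0 : (0 : ℝ) ≤ m := Nat.cast_nonneg m
  obtain ⟨hdeg, hlead⟩ := hahnSeries_degree_leadingCoeff N hα hβ (m + 1)
  obtain ⟨hdeg', hlead'⟩ := hahnSeries_degree_leadingCoeff N hα hβ m
  have horth := fun (q : ℝ[X]) (hq : q.degree < ((m + 1 : ℕ) : WithBot ℕ)) =>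
    discreteBilin_hahnSeries_of_degree_lt hα hβ hN hq
  have hη := discreteBilin_hahnSeries_self hα hβ (by omega : m < N)
  have hPn := eval_hahnSeries_right N α β (m + 1)
  have hBn := eval_hahnSeries_left N α β (m + 1)
  have hPm := eval_hahnSeries_right N α β m
  have hBm := eval_hahnSeries_left N α β m
  set h := hahnSeries N α β (m + 1) with hh
  set h' := hahnSeries N α β m with hh'
  set η := discreteBilin (hahnWeight N α β) N h' h' with hηdef
  set ρ := poch (α + β + (m + 1 : ℕ) + 1) (m + 1) with hρ
  set ρ' := poch (α + β + m + 1) m with hρ'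
  have hρ'0 : ρ' ≠ 0 := by
    rw [← hlead']
    exact leadingCoeff_ne_zero.2 (hahnSeries_ne_zero N hα hβ _)
  have hlt := degree_taylor_one_sub_sub_smul_lt hdeg hdeg' (c := (m + 1) * ρ / ρ')
    (by rw [hlead, hlead']; field_simp)
  -- the two special choices of `p`
  have hgm : discreteBilin (hahnWeight N α β) N (taylor 1 h - h) h' = (m + 1) * ρ / ρ' * η := by
    rw [discreteBilin_comm]
    exact discreteBilin_hahnSeries_of_degree_eq hα hβ (by omega) hlt
  have hgn : discreteBilin (hahnWeight N α β) N (taylor 1 h - h) h = 0 := by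
    rw [discreteBilin_comm]
    refine horth _ ?_
    rw [← hdeg]
    exact degree_taylor_sub_lt 1 (hahnSeries_ne_zero N hα hβ _)
  have twoPoint := fun (p : ℝ[X]) hp => discreteBilin_taylor_sub_eq hα hβ (p := p) horth hp
  have em := twoPoint h' (by rw [hdeg']; exact_mod_cast (by omega))
  have en := twoPoint h (by rw [hdeg]; exact_mod_cast (by omega))
  have ep := twoPoint p (hp.trans (by exact_mod_cast (by omega)))
  rw [hgm] at em
  rw [hgn, mul_zero] at en
  set u := discreteBilin (hahnWeight N α β) N (taylor 1 h - h) (X + C (β + 1))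
  set v := discreteBilin (hahnWeight N α β) N (taylor 1 h - h) (C (N - 1 : ℝ) - X)
  set t := (-1) ^ (m + 1) * hahnMass N α β * (m + 1).factorial / (poch (α + β + 2) m * (N + β))
    with ht
  set W := h.eval (-β - 1) * h'.eval (N - 1 : ℝ) - h.eval (N - 1 : ℝ) * h'.eval (-β - 1) with hW
  set Q := poch (α + 1) m * poch (β + 1) m * poch (1 - N) m * poch (α + β + N + 1) m with hQ
  have hε := neg_one_pow_mul_self m
  have hW' : W = -Q * (α + β + 2 * m + 2) * (N + β) := by
    rw [hW, hPn, hBn, hPm, hBm, pow_succ, poch_succ, poch_succ, poch_succ, poch_succ, hQ]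
    linear_combination (-poch (α + 1) m * poch (β + 1) m * poch (1 - N) m *
      poch (α + β + N + 1) m * (α + β + 2 * m + 2) * (N + β)) * hε
  have hQ0 : Q ≠ 0 := by
    have h1 := (poch_pos (show 0 < α + 1 by linarith) m).ne'
    have h2 := (poch_pos (show 0 < β + 1 by linarith) m).ne'
    have h3 := poch_one_sub_natCast_ne_zero (by omega : m < N)
    have h4 := (poch_pos (show 0 < α + β + N + 1 by linarith) m).ne'
    positivity
  have hW0 : W ≠ 0 := by
    rw [hW']
    have : α + β + 2 * m + 2 ≠ 0 := by linarith
    exact mul_ne_zero (mul_ne_zero (neg_ne_zero.2 hQ0) this) hNβ.ne'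
  have hp1 := poch_add_one_ne_zero (by linarith) hαβ m
  have hp2 := (poch_pos (show 0 < α + β + 2 by linarith) m).ne'
  have hs1 : α + β + 1 ≠ 0 := fun h => hαβ (by linarith)
  have hsm : α + β + m + 1 ≠ 0 ∧ α + β + 2 * m + 1 ≠ 0 := by
    rcases m with _ | m
    · simpa using hs1
    · push_cast
      have : (0 : ℝ) ≤ m := Nat.cast_nonneg m
      constructor <;> linarith
  have hρρ : ρ * (α + β + m + 1) = ρ' * (α + β + 2 * m + 1) * (α + β + 2 * m + 2) := by
    have e1 := poch_succ_left (α + β + m + 1) (m + 1)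
    rw [poch_succ, poch_succ] at e1
    rw [hρ, hρ']
    push_cast at e1 ⊢
    rw [show α + β + (m + 1) + 1 = α + β + m + 1 + 1 by ring, ← hρ'] at *
    linear_combination -e1
  have hpp : poch (α + β + 1) m * (α + β + m + 1) = (α + β + 1) * poch (α + β + 2) m := by
    have e1 := poch_succ_left (α + β + 1) m
    rw [poch_succ, show α + β + 1 + 1 = α + β + 2 by ring] at e1
    linear_combination e1
  have htW : t * W = (m + 1) * ρ / ρ' * η := by
    rw [hW', ht, eq_div_of_mul_eq hsm.1 hρρ, eq_div_of_mul_eq (mul_ne_zero hp1 hsm.2) hη,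
      eq_div_of_mul_eq hsm.1 hpp, Nat.factorial_succ, pow_succ]
    obtain ⟨hsm1, hsm2⟩ := hsm
    push_cast
    generalize α + β + 2 * (m : ℝ) + 1 = x at hsm2 ⊢
    generalize α + β + 2 * (m : ℝ) + 2 = y
    generalize α + β + (m : ℝ) + 1 = z at hsm1 ⊢
    field_simp
  -- Cramer's rule
  have hu : u = (N + β) * t * h.eval (-β - 1) := by
    refine mul_right_cancel₀ hW0 ?_
    rw [hW]
    linear_combination (-h.eval (-β - 1)) * em + h'.eval (-β - 1) * en -
      (N + β) * h.eval (-β - 1) * (htW - t * hW)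
  have hv : v = -((N + β) * t * h.eval (N - 1 : ℝ)) := by
    refine mul_right_cancel₀ hW0 ?_
    rw [hW]
    linear_combination h.eval (N - 1 : ℝ) * em - h'.eval (N - 1 : ℝ) * en +
      (N + β) * h.eval (N - 1 : ℝ) * (htW - t * hW)
  rw [hu, hv] at ep
  refine mul_left_cancel₀ hNβ.ne' ?_
  rw [ep]
  ring

/-- The number `(-1)^k (s+1)_k (s+2k+1) / ((s+1) k!)`. For `s = α + β` it is the inverse squared norm
of `hahnSeries`, up to the total mass and the product `(α+1)_k (β+1)_k (1-N)_k (s+N+1)_k` of the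
values at `N - 1` and `-β - 1`. -/
noncomputable def kernelCoeff (s : ℝ) (k : ℕ) : ℝ :=
  (-1) ^ k * poch (s + 1) k * (s + 2 * k + 1) / ((s + 1) * k.factorial)

/-- The relative Fisher information of the Hahn polynomials as a quadratic form in the values of
the Hahn polynomial of degree `n` at `N - 1` and `-β - 1`, whose coefficients are the values of the
reproducing kernel of degree `n - 1` at these points. -/
theorem relativeFisherInformation_hahnPolynomial_eq_sum {α β : ℝ} (hα : -1 < α) (hβ : -1 < β)
    (hαβ : α + β ≠ -1) {m N : ℕ} (hN : m + 1 < N) :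
    relativeFisherInformation (hahnWeight N α β) N (hahnPolynomial N α β (m + 1)) =
      (-1) ^ (m + 1) * (m + 1).factorial * (α + β + 2 * (m + 1) + 1) /
        (poch (α + β + 2) m * (N + β) ^ 2 * (poch (α + 1) (m + 1) * poch (β + 1) (m + 1) *
          poch (1 - N) (m + 1) * poch (α + β + N + 1) (m + 1))) *
      ((poch (β + 1) (m + 1) * poch (α + β + N + 1) (m + 1)) ^ 2 *
          ∑ k ∈ Finset.range (m + 1), kernelCoeff (α + β) k * (poch (1 - N) k * poch (α + 1) k) /
            (poch (β + 1) k * poch (α + β + N + 1) k) -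
        2 * (poch (α + 1) (m + 1) * poch (β + 1) (m + 1) *
          poch (1 - N) (m + 1) * poch (α + β + N + 1) (m + 1)) *
          ∑ k ∈ Finset.range (m + 1), kernelCoeff (α + β) k +
        (poch (1 - N) (m + 1) * poch (α + 1) (m + 1)) ^ 2 *
          ∑ k ∈ Finset.range (m + 1), kernelCoeff (α + β) k *
            (poch (β + 1) k * poch (α + β + N + 1) k) / (poch (1 - N) k * poch (α + 1) k)) := by
  have hNβ : (N : ℝ) + β ≠ 0 := by
    have : (1 : ℝ) ≤ N := by exact_mod_cast (by omega : 1 ≤ N)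
    linarith
  have hs1 : α + β + 1 ≠ 0 := fun h => hαβ (by linarith)
  have hG := (hahnMass_pos hα hβ N).ne'
  have ha : ∀ k, poch (α + 1) k ≠ 0 := fun k => (poch_pos (by linarith) k).ne'
  have hb : ∀ k, poch (β + 1) k ≠ 0 := fun k => (poch_pos (by linarith) k).ne'
  have hc : ∀ k < N, poch (1 - N : ℝ) k ≠ 0 := fun k hk => poch_one_sub_natCast_ne_zero hk
  have hd : ∀ k, poch (α + β + N + 1) k ≠ 0 := fun k => (poch_pos (by
    have : (1 : ℝ) ≤ N := by exact_mod_cast (by omega : 1 ≤ N)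
    linarith) k).ne'
  have hη : ∀ k < N, (discreteBilin (hahnWeight N α β) N (hahnSeries N α β k)
      (hahnSeries N α β k))⁻¹ = kernelCoeff (α + β) k / (hahnMass N α β *
        (poch (α + 1) k * poch (β + 1) k * poch (1 - N) k * poch (α + β + N + 1) k)) := by
    intro k hk
    have h1 := discreteBilin_hahnSeries_self hα hβ hk
    have h2 := (discreteBilin_hahnSeries_self_pos hα hβ hk).ne'
    have hε := neg_one_pow_mul_self k
    have hak := ha k
    have hbk := hb k
    have hck := hc k hk
    have hdk := hd k
    have hkf : (k.factorial : ℝ) ≠ 0 := by positivity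
    refine (eq_inv_of_mul_eq_one_left ?_).symm
    rw [kernelCoeff]
    field_simp
    linear_combination (-1) ^ k * h1 + (hahnMass N α β * (α + β + 1) * k.factorial *
      (poch (α + 1) k * poch (β + 1) k * poch (1 - N) k * poch (α + β + N + 1) k)) * hε
  rw [relativeFisherInformation_hahnPolynomial hα hβ hN, relativeFisherInformation_eq]
  have hdeg := fun k => (hahnSeries_degree_leadingCoeff N hα hβ k).1
  rw [discreteBilin_self_eq_sum (fun x hx => hahnWeight_pos hα hβ hx) hN.le (fun k _ => hdeg k)
    (fun k hk q hq => discreteBilin_hahnSeries_of_degree_lt hα hβ (by omega) hq)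
    ((degree_taylor_sub_lt 1 (hahnSeries_ne_zero N hα hβ _)).trans_eq (hdeg _)), div_eq_mul_inv, hη _ hN]
  have hterm : ∀ k ∈ Finset.range (m + 1), discreteBilin (hahnWeight N α β) N
        (taylor 1 (hahnSeries N α β (m + 1)) - hahnSeries N α β (m + 1)) (hahnSeries N α β k) ^ 2 /
        discreteBilin (hahnWeight N α β) N (hahnSeries N α β k) (hahnSeries N α β k) =
      hahnMass N α β * (m + 1).factorial ^ 2 / (poch (α + β + 2) m * (N + β)) ^ 2 *
      ((poch (β + 1) (m + 1) * poch (α + β + N + 1) (m + 1)) ^ 2 *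
          (kernelCoeff (α + β) k * (poch (1 - N) k * poch (α + 1) k) /
            (poch (β + 1) k * poch (α + β + N + 1) k)) -
        2 * (poch (α + 1) (m + 1) * poch (β + 1) (m + 1) *
          poch (1 - N) (m + 1) * poch (α + β + N + 1) (m + 1)) * kernelCoeff (α + β) k +
        (poch (1 - N) (m + 1) * poch (α + 1) (m + 1)) ^ 2 *
          (kernelCoeff (α + β) k *
            (poch (β + 1) k * poch (α + β + N + 1) k) / (poch (1 - N) k * poch (α + 1) k))) := by
    intro k hk
    have hk' := Finset.mem_range.1 hk
    have hak := ha k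
    have hbk := hb k
    have hck := hc k (by omega)
    have hdk := hd k
    have hε : (((-1 : ℝ) ^ k) ^ 2) = 1 := by rw [← pow_mul, mul_comm, pow_mul]; simp
    have hε' : (((-1 : ℝ) ^ (m + 1)) ^ 2) = 1 := by rw [← pow_mul, mul_comm, pow_mul]; simp
    rw [div_eq_mul_inv, hη k (by omega),
      discreteBilin_taylor_sub_hahnSeries hα hβ hαβ hN (by rw [hdeg]; exact_mod_cast hk'),
      eval_hahnSeries_left, eval_hahnSeries_right, eval_hahnSeries_left, eval_hahnSeries_right]
    generalize (-1 : ℝ) ^ k = ε at hε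
    generalize (-1 : ℝ) ^ (m + 1) = ε' at hε'
    generalize poch (α + 1) k = a at *
    generalize poch (β + 1) k = b at *
    generalize poch (1 - N : ℝ) k = c at *
    generalize poch (α + β + N + 1) k = d at *
    generalize poch (α + 1) (m + 1) = a' at *
    generalize poch (β + 1) (m + 1) = b' at *
    generalize poch (1 - N : ℝ) (m + 1) = c' at *
    generalize poch (α + β + N + 1) (m + 1) = d' at *
    generalize poch (α + β + 2) m = p at *
    have hsq : (ε' * hahnMass N α β * (m + 1).factorial / (p * (N + β)) *
        (ε' * b' * d' * (ε * c * a) - ε' * c' * a' * (ε * b * d))) ^ 2 =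
        (ε' ^ 2) ^ 2 * ε ^ 2 * (hahnMass N α β * (m + 1).factorial / (p * (N + β)) *
        (b' * d' * (c * a) - c' * a' * (b * d))) ^ 2 := by ring
    rw [hsq, hε, hε']
    field_simp
    ring
  rw [Finset.sum_congr rfl hterm, ← Finset.mul_sum, Finset.sum_add_distrib,
    Finset.sum_sub_distrib, ← Finset.mul_sum, ← Finset.mul_sum, ← Finset.mul_sum]
  have hpp : poch (α + β + 1) (m + 1) = (α + β + 1) * poch (α + β + 2) m := by
    rw [poch_succ_left, show α + β + 1 + 1 = α + β + 2 by ring]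
  have hkc : kernelCoeff (α + β) (m + 1) = (-1) ^ (m + 1) * poch (α + β + 2) m *
      (α + β + 2 * (m + 1) + 1) / (m + 1).factorial := by
    rw [kernelCoeff, hpp]
    push_cast
    field_simp
  have hp := (poch_pos (show 0 < α + β + 2 by linarith) m).ne'
  have hnf : ((m + 1).factorial : ℝ) ≠ 0 := by positivity
  have ha' := ha (m + 1)
  have hb' := hb (m + 1)
  have hc' := hc (m + 1) hN
  have hd' := hd (m + 1)
  rw [hkc, mul_comm, ← mul_assoc]
  congr 1
  field_simp

/-! ### Continuation of the `3F2` and reversal of the `5F4` -/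

theorem isOpen_cutPlane : IsOpen cutPlane := by
  have : IsClosed {z : ℂ | 1 ≤ z.re ∧ z.im = 0} :=
    (isClosed_le continuous_const Complex.continuous_re).inter
      (isClosed_eq Complex.continuous_im continuous_const)
  exact this.isOpen_compl

/-- The binomial series `∑ (a)_k z^k / k! = (1 - z)^(-a)`. -/
theorem hasSum_poch_div_factorial (a : ℝ) {z : ℂ} (hz : ‖z‖ < 1) :
    HasSum (fun k : ℕ => ((poch a k / k.factorial : ℝ) : ℂ) * z ^ k) (1 / (1 - z) ^ (a : ℂ)) := by
  have h := (Complex.one_div_one_sub_cpow_hasFPowerSeriesOnBall_zero (a : ℂ)).hasSum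
    (y := z) (by
      rw [Metric.mem_eball, edist_zero_right, ← ofReal_norm, ENNReal.ofReal_lt_one]
      exact hz)
  rw [zero_add] at h
  refine h.congr_fun fun k => ?_
  have hk : poch a k / k.factorial = Ring.choose (a + k - 1) k := by
    rw [← Ring.multichoose_eq, div_eq_iff (by positivity), mul_comm, ← nsmul_eq_mul,
      Ring.factorial_nsmul_multichoose_eq_ascPochhammer, ascPochhammer_smeval_eq_eval, poch]
  rw [hk, Complex.ofReal_choose, FormalMultilinearSeries.ofScalars_apply_eq, smul_eq_mul]
  push_cast
  rfl

/-- If the sum of a power series continues holomorphically to the cut plane, then so does the sum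
of the series without its first `n` terms, divided by `z^n`. -/
theorem exists_continuation_tail {c : ℕ → ℂ} {G : ℂ → ℂ} (hG : DifferentiableOn ℂ G cutPlane)
    (hs : ∀ z : ℂ, ‖z‖ < 1 → HasSum (fun k : ℕ => c k * z ^ k) (G z)) (n : ℕ) :
    ∃ F : ℂ → ℂ, DifferentiableOn ℂ F cutPlane ∧
      (∀ z : ℂ, ‖z‖ < 1 → HasSum (fun k : ℕ => c (k + n) * z ^ k) (F z)) ∧
      ∀ z, G z = ∑ k ∈ Finset.range n, c k * z ^ k + z ^ n * F z := by
  induction n with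
  | zero => exact ⟨G, hG, by simpa using hs, by simp⟩
  | succ n ih =>
    obtain ⟨F, hF, hsum, hval⟩ := ih
    have hseries : HasFPowerSeriesAt F
        (FormalMultilinearSeries.ofScalars ℂ fun k => c (k + n)) 0 := by
      rw [hasFPowerSeriesAt_iff]
      filter_upwards [Metric.ball_mem_nhds (0 : ℂ) one_pos] with w hw
      rw [zero_add]
      refine (hsum w (by simpa using hw)).congr_fun fun k => ?_
      rw [FormalMultilinearSeries.coeff_ofScalars, smul_eq_mul, mul_comm]
    have h0 : F 0 = c n := by
      have h1 := hsum 0 (by simp)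
      have h2 := hasSum_single (f := fun k : ℕ => c (k + n) * (0 : ℂ) ^ k) 0
        (fun k hk => by simp [hk])
      simpa using h1.unique h2
    have hd : ∀ z, F z = c n + z * dslope F 0 z := fun z => by
      have := sub_smul_dslope F 0 z
      rw [sub_zero, smul_eq_mul, h0] at this
      rw [this]
      ring
    refine ⟨dslope F 0, ?_, fun z hz => ?_, fun z => ?_⟩
    · exact (Complex.differentiableOn_dslope
        (isOpen_cutPlane.mem_nhds (by simp [cutPlane]))).2 hF
    · rcases eq_or_ne z 0 with rfl | hz0
      · have h1 : dslope F 0 0 = c (n + 1) := by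
          rw [dslope_same, hseries.deriv, add_comm n]
          simp
        have h2 := hasSum_single (f := fun k : ℕ => c (k + (n + 1)) * (0 : ℂ) ^ k) 0
          (fun k hk => by simp [hk])
        rw [h1]
        simpa using h2
      · have h1 := (hasSum_nat_add_iff' 1).2 (hsum z hz)
        rw [Finset.sum_range_one, zero_add, pow_zero, mul_one, hd z, add_sub_cancel_left] at h1
        have h2 := h1.mul_left z⁻¹
        rw [inv_mul_cancel_left₀ hz0] at h2
        refine h2.congr_fun fun k => ?_
        rw [pow_succ, show k + (n + 1) = k + 1 + n by ring]
        field_simp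
    · rw [hval, Finset.sum_range_succ, hd, pow_succ]
      ring

theorem differentiableOn_one_sub_cpow (a : ℂ) :
    DifferentiableOn ℂ (fun z : ℂ => 1 / (1 - z) ^ a) cutPlane := by
  intro z hz
  have hmem : 1 - z ∈ Complex.slitPlane := by
    rw [Complex.mem_slitPlane_iff]
    by_contra! h
    refine hz ⟨?_, ?_⟩
    · simpa using h.1
    · simpa using h.2
  have hne : (1 - z) ^ a ≠ 0 := by
    rw [Ne, Complex.cpow_eq_zero_iff]
    rintro ⟨h, -⟩
    rw [h] at hmem
    simp at hmem
  have hd : DifferentiableAt ℂ (fun z : ℂ => (1 - z) ^ a) z :=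
    (by fun_prop : DifferentiableAt ℂ (fun z : ℂ => 1 - z) z).cpow_const hmem
  exact ((differentiableAt_const 1).div hd hne).differentiableWithinAt

/-- The generating function `∑ (s+1)_k (s+2k+1) z^k / k! = (s+1) (1+z) / (1-z)^(s+2)`. -/
theorem hasSum_poch_mul_linear (s : ℝ) {z : ℂ} (hz : ‖z‖ < 1) :
    HasSum (fun k : ℕ => ((poch (s + 1) k * (s + 2 * k + 1) / k.factorial : ℝ) : ℂ) * z ^ k)
      ((s + 1) * (1 + z) * (1 / (1 - z) ^ ((s + 2 : ℝ) : ℂ))) := by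
  have h := hasSum_poch_div_factorial (s + 2) hz
  set G := 1 / (1 - z) ^ ((s + 2 : ℝ) : ℂ)
  have h1 := (h.mul_left ((s + 1 : ℝ) : ℂ))
  have h2 := (h.mul_left (((s + 1 : ℝ) : ℂ) * z))
  rw [← hasSum_nat_add_iff' 1] at h1 ⊢
  convert h1.add h2 using 1
  · ext k
    have e1 := poch_succ_left (s + 1) k
    rw [show s + 1 + 1 = s + 2 by ring] at e1
    have hk : (k.factorial : ℝ) ≠ 0 := by positivity
    have hk1 : (k : ℝ) + 1 ≠ 0 := by positivity
    have e2 : poch (s + 1) (k + 1) * (s + 2 * (k + 1 : ℕ) + 1) / (k + 1).factorial =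
        (s + 1) * (poch (s + 2) (k + 1) / (k + 1).factorial) +
          (s + 1) * (poch (s + 2) k / k.factorial) := by
      rw [e1, poch_succ, Nat.factorial_succ]
      push_cast
      field_simp
      ring
    rw [e2]
    push_cast
    ring
  · simp [poch_zero]
    ring

/-- The coefficients of the `3F2` are those of the generating function
`(s+1) (1+z) / (1-z)^(s+2)`, shifted by `n` and normalized. This gives the continuation. As the
generating function vanishes at `-1`, the value there is a finite sum. -/
theorem exists_isHypergeometricFunction_hahnC {α β : ℝ} (hα : -1 < α) (hβ : -1 < β)
    (hαβ : α + β ≠ -1) {n : ℕ} (hn : 1 ≤ n) :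
    ∃ F : ℂ → ℂ, IsHypergeometricFunction (hahnCUpper n α β) (hahnCLower n α β) F ∧
      (-1) ^ n * ((poch (α + β + 1) n * (α + β + 2 * n + 1) / n.factorial : ℝ) : ℂ) * F (-1) =
        -((((α + β + 1) * ∑ k ∈ Finset.range n, kernelCoeff (α + β) k : ℝ) : ℂ)) := by
  set s := α + β with hs
  have hn1 : (1 : ℝ) ≤ n := by exact_mod_cast hn
  set c : ℕ → ℝ := fun k => poch (s + 1) k * (s + 2 * k + 1) / k.factorial with hc
  have hcn : c n ≠ 0 := by
    have h1 := poch_add_one_ne_zero (by linarith) hαβ n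
    have h2 : s + 2 * n + 1 ≠ 0 := by linarith
    have h3 : (n.factorial : ℝ) ≠ 0 := by positivity
    exact div_ne_zero (mul_ne_zero h1 h2) h3
  have hcn' : (c n : ℂ) ≠ 0 := by exact_mod_cast hcn
  have hdiff : DifferentiableOn ℂ
      (fun z : ℂ => (s + 1) * (1 + z) * (1 / (1 - z) ^ ((s + 2 : ℝ) : ℂ))) cutPlane :=
    DifferentiableOn.mul (by fun_prop) (differentiableOn_one_sub_cpow _)
  obtain ⟨F, hF, hsum, hval⟩ := exists_continuation_tail (c := fun k => (c k : ℂ)) hdiff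
    (fun z hz => hasSum_poch_mul_linear s hz) n
  have hcoeff : ∀ k, c (k + n) = c n * pFqCoeff (hahnCUpper n α β) (hahnCLower n α β) k := by
    intro k
    have hk0 : (0 : ℝ) ≤ k := Nat.cast_nonneg k
    have e1 := poch_add (s + 1) n k
    have e2 := poch_add 1 n k
    have e3 := poch_succ ((s + 1) / 2 + n) k
    rw [poch_succ_left] at e3
    rw [poch_one, poch_one] at e2
    have h1 : poch ((s + 1) / 2 + n) k ≠ 0 := (poch_pos (by linarith) k).ne'
    have h2 : (n.factorial : ℝ) ≠ 0 := by positivity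
    have h3 : poch (1 + n) k ≠ 0 := (poch_pos (by linarith) k).ne'
    have h4 : (k.factorial : ℝ) ≠ 0 := by positivity
    have h5 : (s + 1) / 2 + n ≠ 0 := by linarith
    simp only [hc, pFqCoeff, hahnCUpper, hahnCLower, List.map_cons, List.map_nil, List.prod_cons,
      List.prod_nil, mul_one, poch_one, ← hs]
    rw [add_comm k n, e1, e2, show (s + 3) / 2 + n = (s + 1) / 2 + n + 1 by ring,
      eq_div_of_mul_eq h5 ((mul_comm _ _).trans e3), show s + n + 1 = s + 1 + n by ring,
      show (n : ℝ) + 1 = 1 + n by ring]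
    rw [show s + 2 * (n + k : ℕ) + 1 = 2 * ((s + 1) / 2 + n + k) by push_cast; ring,
      show s + 2 * (n : ℝ) + 1 = 2 * ((s + 1) / 2 + n) by ring]
    generalize (s + 1) / 2 + (n : ℝ) = x at h1 h5 ⊢
    field_simp
  refine ⟨fun z => (c n : ℂ)⁻¹ * F z, ⟨hF.const_mul _, fun z hz => ?_⟩, ?_⟩
  · refine ((hsum z hz).mul_left _).congr_fun fun k => ?_
    simp only [hcoeff]
    push_cast
    field_simp
  · -- the closed form of the whole series vanishes at `z = -1`
    have h := hval (-1)
    rw [add_neg_cancel, mul_zero, zero_mul] at h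
    have hsum' : (((s + 1) * ∑ k ∈ Finset.range n, kernelCoeff s k : ℝ) : ℂ) =
        ∑ k ∈ Finset.range n, (c k : ℂ) * (-1) ^ k := by
      rw [Finset.mul_sum, Complex.ofReal_sum]
      refine Finset.sum_congr rfl fun k _ => ?_
      have h1 : s + 1 ≠ 0 := fun h => hαβ (by linarith)
      have : (s + 1) * kernelCoeff s k = c k * (-1) ^ k := by
        simp only [kernelCoeff, hc]
        field_simp
      rw [this]
      push_cast
      rfl
    rw [hsum', mul_assoc, mul_inv_cancel_left₀ hcn']
    linear_combination -h

theorem neg_one_mem_cutPlane : (-1 : ℂ) ∈ cutPlane := by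
  simp only [cutPlane, Set.mem_ofPred_eq, Complex.neg_re, Complex.one_re]
  norm_num

/-- Reading the terminating `5F4` at `-1` backwards turns it into a partial sum of the kernel; the
prefactor is the last term of that sum. -/
theorem mul_pFq_eq_sum_kernelCoeff {s : ℝ} (hs : -2 < s) (hs1 : s ≠ -1) (m : ℕ)
    {u₁ u₂ v₁ v₂ : ℝ} (hu₁ : ∀ k ≤ m, poch u₁ k ≠ 0) (hu₂ : ∀ k ≤ m, poch u₂ k ≠ 0)
    (hv₁ : ∀ k ≤ m, poch v₁ k ≠ 0) (hv₂ : ∀ k ≤ m, poch v₂ k ≠ 0) :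
    (((-1) ^ m * poch ((s + 3) / 2) m * poch (s + 1) m * (poch v₁ m * poch v₂ m) /
      (m.factorial * poch ((s + 1) / 2) m * (poch u₁ m * poch u₂ m)) : ℝ) : ℂ) *
      pFq [-(m : ℝ), 1, 1 - u₁ - m, 1 - u₂ - m, 1 - (s + 1) / 2 - m]
        [1 - v₁ - m, 1 - v₂ - m, 1 - (s + 3) / 2 - m, 1 - (s + 1) - m] (-1) =
      ((∑ k ∈ Finset.range (m + 1),
        kernelCoeff s k * (poch v₁ k * poch v₂ k) / (poch u₁ k * poch u₂ k) : ℝ) : ℂ) := by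
  rw [pFq_terminating (m := m) (by simp) neg_one_mem_cutPlane, Finset.mul_sum,
    ← Finset.sum_range_reflect (fun k => kernelCoeff s k * _ / _), Complex.ofReal_sum]
  refine Finset.sum_congr rfl fun j hj => ?_
  obtain ⟨i, rfl⟩ := Nat.exists_eq_add_of_le (Nat.lt_succ_iff.1 (Finset.mem_range.1 hj))
  have r := fun a : ℝ => poch_sub_mul_reflect (a := a) (b := 1 - a - (j + i : ℕ))
    (Nat.le_add_right j i) rfl
  have r1 := poch_neg_natCast_mul_factorial (Nat.le_add_right j i)
  simp only [Nat.add_sub_cancel_left] at r r1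
  rw [show j + i + 1 - 1 - j = i by omega]
  have hg : ∀ k, poch ((s + 1) / 2) k ≠ 0 := fun k => by
    have := poch_add_one_ne_zero (s := (s - 1) / 2) (by linarith)
      (fun h => hs1 (by linarith)) k
    rwa [show (s - 1) / 2 + 1 = (s + 1) / 2 by ring] at this
  have hh : ∀ k, poch ((s + 3) / 2) k ≠ 0 := fun k => (poch_pos (by linarith) k).ne'
  have he := poch_add_one_ne_zero hs hs1
  have hi : i ≤ j + i := Nat.le_add_left i j
  have hε := neg_one_pow_mul_self j
  have hε0 : ((-1 : ℝ) ^ j) ≠ 0 := pow_ne_zero _ (by norm_num)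
  have hs1' : s + 1 ≠ 0 := fun h => hs1 (by linarith)
  have hratio : s + 2 * i + 1 = (s + 1) * poch ((s + 3) / 2) i / poch ((s + 1) / 2) i := by
    have e := poch_succ ((s + 1) / 2) i
    rw [poch_succ_left, show (s + 1) / 2 + 1 = (s + 3) / 2 by ring] at e
    rw [eq_div_iff (hg i)]
    linear_combination (-2 : ℝ) * e
  rw [show (-1 : ℂ) ^ j = (((-1) ^ j : ℝ) : ℂ) by push_cast; rfl, ← Complex.ofReal_mul,
    ← Complex.ofReal_mul]
  congr 1
  have q := fun (a : ℝ) (h : poch a i ≠ 0) => eq_div_of_mul_eq h ((mul_comm _ _).trans (r a))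
  have hfi : (i.factorial : ℝ) ≠ 0 := by positivity
  have hfj : (j.factorial : ℝ) ≠ 0 := by positivity
  have hfm : ((j + i).factorial : ℝ) ≠ 0 := by positivity
  simp only [pFqCoeff, List.map_cons, List.map_nil, List.prod_cons, List.prod_nil, mul_one,
    poch_one]
  rw [q u₁ (hu₁ i hi), q u₂ (hu₂ i hi), q v₁ (hv₁ i hi), q v₂ (hv₂ i hi), q _ (hg i), q _ (hh i),
    q _ (he i), eq_div_of_mul_eq hfi r1, kernelCoeff, hratio, pow_add]
  have h1 := hu₁ _ le_rfl
  have h2 := hu₂ _ le_rfl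
  have h3 := hv₁ _ le_rfl
  have h4 := hv₂ _ le_rfl
  have h5 := hg (j + i)
  have h6 := hh (j + i)
  have h7 := he (j + i)
  have h8 := hu₁ _ hi
  have h9 := hu₂ _ hi
  have h10 := hv₁ _ hi
  have h11 := hv₂ _ hi
  have h12 := hg i
  have h13 := hh i
  have h14 := he i
  generalize (-1 : ℝ) ^ j = ε at *
  field_simp
  rw [sq, hε]

/-! ### The factors of the closed formula in terms of Pochhammer symbols -/

theorem hahnA1_mul_hahnA2 {α β : ℝ} (hα : -1 < α) (hβ : -1 < β) (hαβ : α + β ≠ -1) {m N : ℕ}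
    (hN : m + 1 < N) :
    hahnA1 (m + 1) N α β * hahnA2 (m + 1) N α β =
      (-1) ^ (m + 1) * ((m : ℝ) + 1) ^ 2 * (α + β + 2 * (m + 1) + 1) *
        poch (α + β + (m + 1) + 1) (m + 1) ^ 2 * poch (α + β + 2) m /
        ((m + 1).factorial * (poch (α + 1) (m + 1) * poch (β + 1) (m + 1) *
          poch (1 - N) (m + 1) * poch (α + β + N + 1) (m + 1))) := by
  have hN1 : (1 : ℝ) ≤ N := by exact_mod_cast (by omega : 1 ≤ N)
  have hs1 : α + β + 1 ≠ 0 := fun h => hαβ (by linarith)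
  have g1 := Gamma_add_natCast_eq_poch (show 0 < α + β + 2 by linarith) m
  have g2 := Gamma_add_natCast_eq_poch (show 0 < α + 1 by linarith) (m + 1)
  have g3 := Gamma_add_natCast_eq_poch (show 0 < β + 1 by linarith) (m + 1)
  have g4 := Gamma_add_natCast_eq_poch (show 0 < α + β + N + 1 by linarith) (m + 1)
  have g5 := Real.Gamma_add_one hs1
  have p1 := (Real.Gamma_pos_of_pos (show 0 < α + β + 2 by linarith)).ne'
  have p2 := (Real.Gamma_pos_of_pos (show 0 < α + 1 by linarith)).ne'
  have p3 := (Real.Gamma_pos_of_pos (show 0 < β + 1 by linarith)).ne'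
  have p4 := (Real.Gamma_pos_of_pos (show 0 < α + β + N + 1 by linarith)).ne'
  have q2 := (poch_pos (show 0 < α + 1 by linarith) (m + 1)).ne'
  have q3 := (poch_pos (show 0 < β + 1 by linarith) (m + 1)).ne'
  have q4 := (poch_pos (show 0 < α + β + N + 1 by linarith) (m + 1)).ne'
  have q5 := poch_one_sub_natCast_ne_zero hN
  have hf := poch_neg_natCast_mul_factorial (show m + 1 ≤ N - 1 by omega)
  rw [show (-((N - 1 : ℕ) : ℝ)) = 1 - N by push_cast [Nat.cast_sub (by omega : 1 ≤ N)]; ring,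
    show N - 1 - (m + 1) = N - (m + 1) - 1 by omega] at hf
  have hNf : ((N - 1).factorial : ℝ) ≠ 0 := by positivity
  have hnf : ((m + 1).factorial : ℝ) ≠ 0 := by positivity
  rw [show α + β + 1 + 1 = α + β + 2 by ring] at g5
  rw [hahnA1, hahnA2, eq_div_of_mul_eq hs1 ((mul_comm _ _).trans g5.symm)]
  push_cast at g2 g3 g4 ⊢
  rw [show α + β + ((m : ℝ) + 1) + 1 = α + β + 2 + m by ring, g1,
    show α + ((m : ℝ) + 1) + 1 = α + 1 + (m + 1) by ring, g2,
    show β + ((m : ℝ) + 1) + 1 = β + 1 + (m + 1) by ring, g3,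
    show α + β + N + ((m : ℝ) + 1) + 1 = α + β + N + 1 + (m + 1) by ring, g4,
    eq_div_of_mul_eq q5 ((mul_comm _ _).trans hf)]
  field_simp

/-- Both sides are `(s+2)_{2m+1}`, split in two ways. -/
theorem poch_mul_poch_mul_eq (s : ℝ) (m : ℕ) :
    poch (s + (m + 1) + 2) m * poch (s + 3) m * (s + 2) =
      poch (s + 2) m * poch (s + (m + 1) + 1) (m + 1) := by
  have e1 := poch_add (s + 2) (m + 1) m
  have e2 := poch_add (s + 2) m (m + 1)
  have e3 := poch_succ_left (s + 2) m
  rw [show m + (m + 1) = m + 1 + m by ring, e1, e3] at e2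
  push_cast at e2
  rw [show s + 2 + ((m : ℝ) + 1) = s + (m + 1) + 2 by ring, show s + 2 + 1 = s + 3 by ring,
    show s + 2 + (m : ℝ) = s + (m + 1) + 1 by ring] at e2
  linear_combination e2

theorem hahnB1_eq (α β : ℝ) (m N : ℕ) :
    hahnB1 (m + 1) N α β = (m.factorial * poch (β + 1) (m + 1) * poch (α + β + N + 1) (m + 1) /
      (poch (α + β + 2) m * poch (α + β + (m + 1) + 1) (m + 1) * (N + β))) ^ 2 := by
  rw [hahnB1, ← poch_mul_poch_mul_eq, Nat.add_sub_cancel, poch_succ_left (β + 1),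
    poch_succ_left (α + β + N + 1),
    poch_reflect (a := α + β + N + 1 + 1) (k := m) (b := -α - β - (m + 1 : ℕ) - N)
      (by push_cast; ring),
    poch_reflect (a := α + β + 3) (k := m) (b := -α - β - (m + 1 : ℕ) - 1) (by push_cast; ring),
    show β + 1 + 1 = β + 2 by ring, ← mul_div_mul_left _ _ (pow_ne_zero m (neg_ne_zero.2 one_ne_zero) :
      (-1 : ℝ) ^ m ≠ 0)]
  push_cast
  congr 2
  · linear_combination ((m.factorial : ℝ) * (β + 1) * (α + β + N + 1) *
      poch (α + β + N + 1 + 1) m * poch (β + 2) m) * neg_one_pow_mul_self m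
  · linear_combination (poch (α + β + (m + 1) + 2) m * poch (α + β + 3) m * (α + β + 2) *
      (N + β)) * neg_one_pow_mul_self m

theorem hahnD1_eq (α β : ℝ) (m N : ℕ) :
    hahnD1 (m + 1) N α β = (m.factorial * poch (1 - N) (m + 1) * poch (α + 1) (m + 1) /
      (poch (α + β + 2) m * poch (α + β + (m + 1) + 1) (m + 1) * (N + β))) ^ 2 := by
  rw [hahnD1, ← poch_mul_poch_mul_eq, Nat.add_sub_cancel, poch_succ_left (α + 1),
    poch_succ_left (1 - N : ℝ),
    poch_reflect (a := α + 1 + 1) (k := m) (b := -α - (m + 1 : ℕ)) (by push_cast; ring),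
    poch_reflect (a := α + β + 3) (k := m) (b := -α - β - (m + 1 : ℕ) - 1) (by push_cast; ring),
    show (1 : ℝ) - N + 1 = -N + 2 by ring,
    ← mul_div_mul_left _ _ (pow_ne_zero m (neg_ne_zero.2 one_ne_zero) : (-1 : ℝ) ^ m ≠ 0),
    ← neg_sq, ← neg_div]
  push_cast
  congr 2
  · linear_combination ((m.factorial : ℝ) * (1 - N) * (α + 1) *
      poch (α + 1 + 1) m * poch (-N + 2) m) * neg_one_pow_mul_self m
  · linear_combination (poch (α + β + (m + 1) + 2) m * poch (α + β + 3) m * (α + β + 2) *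
      (N + β)) * neg_one_pow_mul_self m

theorem hahnC1_mul_hahnC2 (α β : ℝ) (m N : ℕ) :
    hahnC1 (m + 1) N α β * hahnC2 (m + 1) N α β =
      2 * (-1) ^ (m + 1) * (m.factorial : ℝ) ^ 2 * (poch (α + 1) (m + 1) * poch (β + 1) (m + 1) *
          poch (1 - N) (m + 1) * poch (α + β + N + 1) (m + 1)) * (α + β + 2 * (m + 1) + 1) /
        ((poch (α + β + 2) m * poch (α + β + (m + 1) + 1) (m + 1)) ^ 2 *
          ((m + 1).factorial * (N + β) ^ 2 * Real.Gamma (α + β + 2))) := by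
  rw [hahnC1, hahnC2, ← poch_mul_poch_mul_eq, Nat.add_sub_cancel, poch_succ_left (α + 1),
    poch_succ_left (β + 1), poch_succ_left (1 - N : ℝ), poch_succ_left (α + β + N + 1),
    poch_reflect (a := α + 1 + 1) (k := m) (b := -α - (m + 1 : ℕ)) (by push_cast; ring),
    poch_reflect (a := α + β + N + 1 + 1) (k := m) (b := -α - β - (m + 1 : ℕ) - N)
      (by push_cast; ring),
    poch_reflect (a := α + β + 3) (k := m) (b := -α - β - (m + 1 : ℕ) - 1) (by push_cast; ring),
    show (1 : ℝ) - N + 1 = 2 - N by ring, show β + 1 + 1 = β + 2 by ring, div_mul_div_comm]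
  push_cast
  have h := neg_one_pow_mul_self m
  congr 1
  · linear_combination (2 * (-1) ^ (m + 1) * (m.factorial : ℝ) ^ 2 * (β + 1) * (α + β + N + 1) *
      poch (α + β + N + 1 + 1) m * (poch (β + 2) m * (1 - N) * (α + 1) * poch (α + 1 + 1) m *
      poch (2 - N : ℝ) m * (α + β + 2 * (m + 1) + 1))) * h
  · linear_combination (poch (α + β + (m + 1) + 2) m ^ 2 * poch (α + β + 3) m ^ 2 *
      (α + β + 2) ^ 2 * ((m + 1).factorial * (N + β) ^ 2 * Real.Gamma (α + β + 2))) * h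

/-- Up to explicit factors, the value of the `3F2` at `-1` is a finite sum, the value at
`(N - 1, -β - 1)` of the reproducing kernel of degree `n - 1`. -/
theorem hahnC3_eq {α β : ℝ} (hα : -1 < α) (hβ : -1 < β) (hαβ : α + β ≠ -1) (m : ℕ) :
    hahnC3 (m + 1) α β = (((-1) ^ m * Real.Gamma (α + β + 2) * (m + 1).factorial /
      (α + β + 2 * (m + 1) + 1) *
      ∑ k ∈ Finset.range (m + 1), kernelCoeff (α + β) k : ℝ) : ℂ) := by
  obtain ⟨F, hF, hval⟩ := exists_isHypergeometricFunction_hahnC hα hβ hαβ (Nat.le_add_left 1 m)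
  rw [hahnC3, pFq_eq hF neg_one_mem_cutPlane]
  have hs1 : α + β + 1 ≠ 0 := fun h => hαβ (by linarith)
  have hm0 : (0 : ℝ) ≤ m := Nat.cast_nonneg m
  have g1 := Gamma_add_natCast_eq_poch (show 0 < α + β + 2 by linarith) m
  have hp := (poch_pos (show 0 < α + β + 2 by linarith) m).ne'
  have hx : α + β + 2 * ((m : ℝ) + 1) + 1 ≠ 0 := by linarith
  have hnf : ((m + 1).factorial : ℝ) ≠ 0 := by positivity
  set S := ∑ k ∈ Finset.range (m + 1), kernelCoeff (α + β) k
  have hF1 : F (-1) = (((-1) ^ m * (m + 1).factorial /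
      (poch (α + β + 2) m * (α + β + 2 * (m + 1) + 1)) * S : ℝ) : ℂ) := by
    have hc0 : (-1) ^ (m + 1) * (poch (α + β + 1) (m + 1) * (α + β + 2 * (m + 1 : ℕ) + 1) /
        (m + 1).factorial) ≠ 0 := by
      have h1 := poch_add_one_ne_zero (by linarith) hαβ (m + 1)
      push_cast
      have : ((-1 : ℝ)) ^ (m + 1) ≠ 0 := pow_ne_zero _ (by norm_num)
      positivity
    have hval' := hval
    rw [show (-1 : ℂ) ^ (m + 1) = (((-1) ^ (m + 1) : ℝ) : ℂ) by push_cast; rfl,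
      ← Complex.ofReal_mul] at hval'
    refine mul_left_cancel₀ (Complex.ofReal_ne_zero.2 hc0) (hval'.trans ?_)
    rw [← Complex.ofReal_neg, ← Complex.ofReal_mul]
    congr 1
    rw [poch_succ_left, show α + β + 1 + 1 = α + β + 2 by ring, pow_succ]
    push_cast
    field_simp
    rw [sq, neg_one_pow_mul_self, mul_one]
  rw [hF1, ← Complex.ofReal_mul]
  congr 1
  push_cast
  rw [show α + β + ((m : ℝ) + 1) + 1 = α + β + 2 + m by ring, g1]
  field_simp

/-- The order of the parameters is immaterial. -/
theorem pFq_congr_perm {a a' b b' : List ℝ} (ha : a.Perm a') (hb : b.Perm b') :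
    pFq a b = pFq a' b' := by
  have h : pFqCoeff a b = pFqCoeff a' b' := funext fun k => by
    rw [pFqCoeff, pFqCoeff, (ha.map _).prod_eq, (hb.map _).prod_eq]
  have h' : IsHypergeometricFunction a b = IsHypergeometricFunction a' b' := by
    unfold IsHypergeometricFunction
    rw [h]
  unfold pFq
  rw [h']

/-- The first sum is the value at `(N - 1, N - 1)` of the reproducing kernel of degree `n - 1`, up to
the total mass. -/
theorem hahnB2_mul_hahnB3 {α β : ℝ} (hα : -1 < α) (hβ : -1 < β) (hαβ : α + β ≠ -1) {m N : ℕ}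
    (hN : m + 1 < N) :
    (hahnB2 (m + 1) N α β : ℂ) * hahnB3 (m + 1) N α β =
      ((∑ k ∈ Finset.range (m + 1), kernelCoeff (α + β) k * (poch (1 - N) k * poch (α + 1) k) /
            (poch (β + 1) k * poch (α + β + N + 1) k) : ℝ) : ℂ) := by
  have hN1 : (1 : ℝ) ≤ N := by exact_mod_cast (by omega : 1 ≤ N)
  rw [← mul_pFq_eq_sum_kernelCoeff (by linarith) hαβ m
    (fun k _ => (poch_pos (by linarith) k).ne') (fun k _ => (poch_pos (by linarith) k).ne')
    (fun k hk => poch_one_sub_natCast_ne_zero (by omega))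
    (fun k _ => (poch_pos (by linarith) k).ne')]
  rw [hahnB2, hahnB3, Nat.add_sub_cancel]
  congr 1
  · congr 1
    ring
  · push_cast
    rw [show (1 : ℝ) - (m + 1) = -m by ring,
      show -(m : ℝ) - β = 1 - (β + 1) - m by ring,
      show -(m : ℝ) - α - β - N = 1 - (α + β + N + 1) - m by ring,
      show 2 - ((m : ℝ) + 1) - (α + β + 1) / 2 = 1 - (α + β + 1) / 2 - m by ring,
      show 2 - ((m : ℝ) + 1) - (α + β + 3) / 2 = 1 - (α + β + 3) / 2 - m by ring,
      show -(m : ℝ) - α - β = 1 - (α + β + 1) - m by ring,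
      show -(m : ℝ) - α = 1 - (α + 1) - m by ring,
      show -(m : ℝ) + N = 1 - (1 - N) - m by ring]
    refine congrFun (pFq_congr_perm (List.Perm.refl _) ?_) (-1)
    generalize 1 - (α + 1) - (m : ℝ) = x₁
    generalize 1 - (α + β + 3) / 2 - (m : ℝ) = x₂
    generalize 1 - (α + β + 1) - (m : ℝ) = x₃
    generalize 1 - (1 - (N : ℝ)) - m = x₄
    exact (List.perm_append_comm (l₁ := [x₁, x₂, x₃]) (l₂ := [x₄])).trans (List.Perm.refl _)

/-- The third sum is the value at `(-β - 1, -β - 1)` of the reproducing kernel of degree `n - 1`, up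
to the total mass. -/
theorem hahnD2_mul_hahnD3 {α β : ℝ} (hα : -1 < α) (hβ : -1 < β) (hαβ : α + β ≠ -1) {m N : ℕ}
    (hN : m + 1 < N) :
    (hahnD2 (m + 1) N α β : ℂ) * hahnD3 (m + 1) N α β =
      ((∑ k ∈ Finset.range (m + 1), kernelCoeff (α + β) k *
        (poch (β + 1) k * poch (α + β + N + 1) k) / (poch (1 - N) k * poch (α + 1) k) : ℝ) : ℂ) := by
  have hN1 : (1 : ℝ) ≤ N := by exact_mod_cast (by omega : 1 ≤ N)
  rw [← mul_pFq_eq_sum_kernelCoeff (by linarith) hαβ m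
    (fun k hk => poch_one_sub_natCast_ne_zero (by omega))
    (fun k _ => (poch_pos (by linarith) k).ne')
    (fun k _ => (poch_pos (by linarith) k).ne') (fun k _ => (poch_pos (by linarith) k).ne')]
  rw [hahnD2, hahnD3, Nat.add_sub_cancel]
  congr 1
  · congr 1
    ring
  · push_cast
    rw [show (1 : ℝ) - (m + 1) = -m by ring,
      show -(m : ℝ) - β = 1 - (β + 1) - m by ring,
      show -(m : ℝ) - α - β - N = 1 - (α + β + N + 1) - m by ring,
      show 2 - ((m : ℝ) + 1) - (α + β + 1) / 2 = 1 - (α + β + 1) / 2 - m by ring,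
      show 2 - ((m : ℝ) + 1) - (α + β + 3) / 2 = 1 - (α + β + 3) / 2 - m by ring,
      show -(m : ℝ) - α - β = 1 - (α + β + 1) - m by ring,
      show -(m : ℝ) - α = 1 - (α + 1) - m by ring,
      show -(m : ℝ) + N = 1 - (1 - N) - m by ring]
    refine congrFun (pFq_congr_perm (List.Perm.refl _) ?_) (-1)
    generalize 1 - (α + β + 3) / 2 - (m : ℝ) = x₁
    generalize 1 - (α + β + 1) - (m : ℝ) = x₄
    generalize 1 - (β + 1) - (m : ℝ) = x₂
    generalize 1 - (α + β + N + 1) - (m : ℝ) = x₃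
    exact (List.perm_append_comm (l₁ := [x₁]) (l₂ := [x₂, x₃])).append_right [x₄]

theorem mainTheorem5 (α β : ℝ) (hα : -1 < α) (hβ : -1 < β) (hαβ : α + β ≠ -1)
    (n N : ℕ) (hn : 1 ≤ n) (hnN : n < N) :
    (∃ F : ℂ → ℂ, IsHypergeometricFunction (hahnCUpper n α β) (hahnCLower n α β) F) ∧
    (relativeFisherInformation (hahnWeight N α β) N (hahnPolynomial N α β n) : ℂ) =
      (hahnA1 n N α β : ℂ) * (hahnA2 n N α β : ℂ) *
        ((hahnB1 n N α β : ℂ) * (hahnB2 n N α β : ℂ) * hahnB3 n N α β +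
          (hahnC1 n N α β : ℂ) * (hahnC2 n N α β : ℂ) * hahnC3 n α β +
          (hahnD1 n N α β : ℂ) * (hahnD2 n N α β : ℂ) * hahnD3 n N α β) := by
  obtain ⟨F, hF, -⟩ := exists_isHypergeometricFunction_hahnC hα hβ hαβ hn
  refine ⟨⟨F, hF⟩, ?_⟩
  obtain ⟨m, rfl⟩ : ∃ m, n = m + 1 := ⟨n - 1, by omega⟩
  have hN1 : (1 : ℝ) ≤ N := by exact_mod_cast (by omega : 1 ≤ N)
  have hm0 : (0 : ℝ) ≤ m := Nat.cast_nonneg m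
  rw [mul_assoc (hahnB1 (m + 1) N α β : ℂ), hahnB2_mul_hahnB3 hα hβ hαβ hnN,
    mul_assoc (hahnD1 (m + 1) N α β : ℂ), hahnD2_mul_hahnD3 hα hβ hαβ hnN,
    hahnC3_eq hα hβ hαβ, relativeFisherInformation_hahnPolynomial_eq_sum hα hβ hαβ hnN]
  simp only [← Complex.ofReal_mul, ← Complex.ofReal_add]
  congr 1
  rw [hahnA1_mul_hahnA2 hα hβ hαβ hnN, hahnB1_eq, hahnD1_eq, hahnC1_mul_hahnC2]
  have p1 := (Real.Gamma_pos_of_pos (show 0 < α + β + 2 by linarith)).ne'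
  have q1 := (poch_pos (show 0 < α + β + 2 by linarith) m).ne'
  have q2 := (poch_pos (show 0 < α + 1 by linarith) (m + 1)).ne'
  have q3 := (poch_pos (show 0 < β + 1 by linarith) (m + 1)).ne'
  have q4 := (poch_pos (show 0 < α + β + N + 1 by linarith) (m + 1)).ne'
  have q5 := poch_one_sub_natCast_ne_zero hnN
  have q6 := (poch_pos (show 0 < α + β + ((m : ℝ) + 1) + 1 by linarith) (m + 1)).ne'
  have hNβ : (N : ℝ) + β ≠ 0 := by linarith
  have hx : α + β + 2 * ((m : ℝ) + 1) + 1 ≠ 0 := by linarith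
  have hf0 : (m.factorial : ℝ) ≠ 0 := by positivity
  have hm1 : (m : ℝ) + 1 ≠ 0 := by positivity
  have hε := neg_one_pow_mul_self m
  rw [Nat.factorial_succ, pow_succ (-1 : ℝ)]
  push_cast
  generalize (-1 : ℝ) ^ m = ε at *
  generalize (∑ k ∈ Finset.range (m + 1), kernelCoeff (α + β) k * (poch (1 - N : ℝ) k *
    poch (α + 1) k) / (poch (β + 1) k * poch (α + β + N + 1) k)) = S₁
  generalize (∑ k ∈ Finset.range (m + 1), kernelCoeff (α + β) k) = S₂
  generalize (∑ k ∈ Finset.range (m + 1), kernelCoeff (α + β) k * (poch (β + 1) k *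
    poch (α + β + N + 1) k) / (poch (1 - N : ℝ) k * poch (α + 1) k)) = S₃
  generalize poch (α + 1) (m + 1) = a at *
  generalize poch (β + 1) (m + 1) = b at *
  generalize poch (1 - N : ℝ) (m + 1) = c at *
  generalize poch (α + β + N + 1) (m + 1) = d at *
  generalize poch (α + β + 2) m = p at *
  generalize poch (α + β + ((m : ℝ) + 1) + 1) (m + 1) = r at *
  generalize α + β + 2 * ((m : ℝ) + 1) + 1 = x at *
  field_simp
  linear_combination (-2 * a * b * c * d * S₂ * ε) * hε
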